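/- For integers $n\ge 1$ and reals $r>0$ let $S(n,r)=\{te^{2k\pi i/n} : 0\le t<r,\ k\in\mathbb{Z}\}\subset\mathbb{C}$ be the star-shaped set of valence $n$, equipped with its path metric or, alternatively, with the metric induced from $\mathbb{C}$ (both conventions are allowed). A point $p$ of a metric space has valence $n$ if it has a neighbourhood isometric to some $S(n,r)$ with $p$ corresponding to $0$. A metric graph is a compact connected metric space $\Gamma$ in which every point has some valence $n\ge 1$. A real structure on $\Gamma$ is an isometry $\iota:\Gamma\to\Gamma$ with $\iota\circ\iota=\mathrm{id}$; we write $\overline{p}=\iota(p)$, we call $p$ real if $\overline{p}=p$, and we let $\Gamma(\mathbb{R})$ be the set of real points. Let $X$ be a metric graph or a connected component of $\Gamma(\mathbb{R})$ (which is a point or again a graph). Its vertices are the points that do not have valence $2$ in $X$ (an isolated point is a vertex), its edges are the connected components of the complement of the vertex set that are homeomorphic to an open interval (all of them, except that a circle has neither vertices nor edges), and its genus is $$g(X)=\#\{\text{connected components of }X\}+\#\{\text{edges}\}-\#\{\text{vertices}\},$$ so that a point has genus $0$ and a circle has genus $1$. Put $s(\Gamma)=\sum_i\bigl(g(\Gamma_i)+1\bigr)$,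 where $\Gamma_i$ runs over the connected components of $\Gamma(\mathbb{R})$. Put $a(\Gamma)=1$ if there is a non-real point $p$ that is connected to $\overline{p}$ by a path in $\Gamma$ containing no real point, and $a(\Gamma)=0$ otherwise. **Proposition.** Let $\Gamma$ be a metric graph with a real structure. Then all these numbers are well defined: $\Gamma$ has finitely many vertices and edges, $\Gamma(\mathbb{R})$ has finitely many connected components, and each of these has finitely many vertices and edges. Moreover $$s(\Gamma)\le g(\Gamma)+1,\qquad s(\Gamma)\equiv g(\Gamma)+1 \pmod 2,$$ and $s(\Gamma)\le g(\Gamma)-1$ if $a(\Gamma)=1$. -/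

import Mathlib

open Set Topology

namespace RealMetricGraph

noncomputable section

/-- The star-shaped set `S(n, r) ⊆ ℂ` of valence `n ≥ 1` and radius `r > 0`. -/
def starShaped (n : ℕ) (r : ℝ) : Set ℂ :=
  {z | ∃ (t : ℝ) (k : ℤ), 0 ≤ t ∧ t < r ∧
    z = (t : ℂ) * Complex.exp (2 * (k : ℂ) * (Real.pi : ℂ) * Complex.I / (n : ℂ))}

open Classical in
/-- The path metric on a star-shaped set: `‖z - w‖` on a common ray, and otherwise the length
`‖z‖ + ‖w‖` of the way through the centre. -/
def starDist (z w : ℂ) : ℝ :=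
  if SameRay ℝ z w then ‖z - w‖ else ‖z‖ + ‖w‖

/-- `p` has a neighbourhood that is isometric to a star-shaped set of valence `n`, with `p`
corresponding to the centre. The star-shaped set carries either its path metric or the metric
induced from `ℂ`; both conventions are admitted (they agree for `n ≤ 2`). -/
def HasValence {X : Type*} [MetricSpace X] (p : X) (n : ℕ) : Prop :=
  ∃ r : ℝ, 0 < r ∧ ∃ U ∈ 𝓝 p, ∃ φ : X → ℂ, BijOn φ U (starShaped n r) ∧ φ p = 0 ∧
    ((∀ x ∈ U, ∀ y ∈ U, dist x y = starDist (φ x) (φ y)) ∨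
      (∀ x ∈ U, ∀ y ∈ U, dist x y = dist (φ x) (φ y)))

/-- A metric graph: a compact connected metric space in which every point has a neighbourhood
isometric to a star-shaped set of some valence `n ≥ 1`. -/
structure IsMetricGraph (Γ : Type*) [MetricSpace Γ] : Prop where
  compact : CompactSpace Γ
  connected : ConnectedSpace Γ
  star : ∀ p : Γ, ∃ n : ℕ, 1 ≤ n ∧ HasValence p n

/-- The vertices: the points whose valence is not `2`. An isolated point is a vertex. -/
def vertexSet (X : Type*) [MetricSpace X] : Set X :=
  {p | ¬ HasValence p 2}

/-- The edges: the connected components of the complement of the vertex set that are open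
segments. In a metric graph, or in a component of a real locus, every component of this complement
is an open segment, except for a circle, which has neither vertices nor edges. -/
def edgeSet (X : Type*) [MetricSpace X] : Set (Set X) :=
  {e | (∃ x ∈ (vertexSet X)ᶜ, e = connectedComponentIn (vertexSet X)ᶜ x) ∧ Nonempty (e ≃ₜ ℝ)}

/-- There are finitely many vertices and edges. -/
def IsFiniteGraph (X : Type*) [MetricSpace X] : Prop :=
  (vertexSet X).Finite ∧ (edgeSet X).Finite

/-- The genus: number of connected components plus number of edges minus number of vertices.
It is `0` for a point and `1` for a circle. -/
def genus (X : Type*) [MetricSpace X] : ℤ :=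
  (Nat.card (ConnectedComponents X) : ℤ) + ((edgeSet X).ncard : ℤ) - ((vertexSet X).ncard : ℤ)

/-- A real structure: an isometry `ι` with `ι ∘ ι = id`. -/
structure IsRealStructure {Γ : Type*} [MetricSpace Γ] (ι : Γ → Γ) : Prop where
  isometry : Isometry ι
  involutive : Function.Involutive ι

/-- The set of real points. -/
def realLocus {Γ : Type*} (ι : Γ → Γ) : Set Γ :=
  {p | ι p = p}

/-- A connected component of the real locus, as a metric subspace. -/
abbrev realComponent {Γ : Type*} [MetricSpace Γ] (ι : Γ → Γ)
    (C : ConnectedComponents (realLocus ι)) : Set (realLocus ι) :=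
  {x | ConnectedComponents.mk x = C}

/-- `s(Γ) = ∑ᵢ (g(Γᵢ) + 1)`, summed over the connected components `Γᵢ` of the real locus. -/
def sInvariant {Γ : Type*} [MetricSpace Γ] (ι : Γ → Γ) : ℤ :=
  ∑ᶠ C : ConnectedComponents (realLocus ι), (genus (realComponent ι C) + 1)

open Classical in
/-- `a(Γ) = 1` if some non-real point is joined to its conjugate by a path without real points,
and `a(Γ) = 0` otherwise. -/
def aInvariant {Γ : Type*} [MetricSpace Γ] (ι : Γ → Γ) : ℕ :=
  if ∃ p : Γ, p ∉ realLocus ι ∧ JoinedIn (realLocus ι)ᶜ p (ι p) then 1 else 0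

end

end RealMetricGraph

/-! Cut `Γ` into finitely many isometric segments, with an `ι`-invariant vertex set `V` that
contains the frontier of `Γ(ℝ)`. The frontier is finite: near a real point, a ray through another
real point is fixed pointwise, because an isometry preserves the distances to both. Every open
segment is then real or free of real points.

The genus can be computed from any subdivision. Removing a superfluous vertex of valence `2` either
joins two segments or closes one to a circle, which is no longer counted as an edge; in both cases
the number of edges minus the number of vertices is unchanged (`IsPartition.exists_remove`,
`IsSubdivision.isFiniteGraph_and_genus_eq`). The same applies to the components of `Γ(ℝ)`.

Let `c` be the number of components of `Γ(ℝ)`. The nonreal vertices form pairs, `2a` in number. So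
do the nonreal edges, `2b` in number, since an involution of an open interval has a fixed point.
Counting gives `g + 1 - s = 2 (1 + b - a - c)`, hence the congruence. Divide `Γ` by `ι`, contract
each real component to a node and discard the real edges: the result is a connected graph with `a +
c` nodes and `b` edges, so `a + c ≤ b + 1`, which is the inequality.

In the extremal case this graph is a tree, so every function from its edges to `ZMod 2` is a
coboundary. This permits labelling one member of each nonreal pair `0` and the other `1`,
consistently along all nonreal edges. The two labels split the complement of `Γ(ℝ)` into two open
sets exchanged by `ι`, so no nonreal point is joined to its conjugate there (`exists_card_nonreal`).
Thus `a(Γ) = 1` forces `a + c ≤ b`, that is `s ≤ g - 1`. -/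

namespace RealMetricGraph

/-! ### Isometric arcs, star charts and line charts -/

/-- `γ` is an isometry on `s`. -/
def IsometryOn {X : Type*} [MetricSpace X] (γ : ℝ → X) (s : Set ℝ) : Prop :=
  ∀ x ∈ s, ∀ y ∈ s, dist (γ x) (γ y) = |x - y|

theorem IsometryOn.mono {X : Type*} [MetricSpace X] {γ : ℝ → X} {s t : Set ℝ}
    (h : IsometryOn γ t) (hst : s ⊆ t) : IsometryOn γ s :=
  fun x hx y hy => h x (hst hx) y (hst hy)

theorem IsometryOn.injOn {X : Type*} [MetricSpace X] {γ : ℝ → X} {s : Set ℝ}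
    (h : IsometryOn γ s) : InjOn γ s := by
  intro x hx y hy hxy
  have := h x hx y hy
  rw [hxy, dist_self] at this
  linarith [abs_eq_zero.1 this.symm]

theorem IsometryOn.isometry_restrict {X : Type*} [MetricSpace X] {γ : ℝ → X} {s : Set ℝ}
    (h : IsometryOn γ s) : Isometry (s.domRestrict γ) :=
  Isometry.of_dist_eq fun x y => by
    rw [domRestrict_apply, domRestrict_apply, h x x.2 y y.2, Subtype.dist_eq, Real.dist_eq]

theorem IsometryOn.continuousOn {X : Type*} [MetricSpace X] {γ : ℝ → X} {s : Set ℝ}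
    (h : IsometryOn γ s) : ContinuousOn γ s :=
  continuousOn_iff_continuous_domRestrict.2 h.isometry_restrict.continuous

/-- A star chart at `p`: isometric rays issuing from `p` that cover the closed ball of radius `ε`,
such that points of different rays are never at the distance that points of a common ray have. -/
structure IsStar {X I : Type*} [MetricSpace X] (p : X) (ρ : I → ℝ → X) (ε : ℝ) : Prop where
  pos : 0 < ε
  zero : ∀ u, ρ u 0 = p
  isometryOn : ∀ u, IsometryOn (ρ u) (Icc 0 ε)
  ray_eq : ∀ u w, ∀ s ∈ Ioc 0 ε, ∀ t ∈ Ioc 0 ε, dist (ρ u s) (ρ w t) = |s - t| → u = w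
  cover : ∀ x, dist x p ≤ ε → ∃ u, x = ρ u (dist x p)

/-- The unit vectors that span the rays of a star-shaped set. -/
def directions (n : ℕ) : Set ℂ :=
  range fun k : ℤ => Complex.exp (2 * (k : ℂ) * (Real.pi : ℂ) * Complex.I / (n : ℂ))

theorem norm_of_mem_directions {n : ℕ} {u : ℂ} (hu : u ∈ directions n) : ‖u‖ = 1 := by
  obtain ⟨k, rfl⟩ := hu
  have : (2 * (k : ℂ) * (Real.pi : ℂ) * Complex.I / (n : ℂ)) =
      ((2 * k * Real.pi / n : ℝ) : ℂ) * Complex.I := by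
    push_cast; ring
  simp only [this, Complex.norm_exp_ofReal_mul_I]

theorem finite_directions {n : ℕ} (hn : 1 ≤ n) : (directions n).Finite := by
  refine ((Polynomial.nthRoots n (1 : ℂ)).toFinset.finite_toSet).subset ?_
  rintro _ ⟨k, rfl⟩
  simp only [Finset.mem_coe, Multiset.mem_toFinset]
  rw [Polynomial.mem_nthRoots (by omega), ← Complex.exp_nat_mul, Complex.exp_eq_one_iff]
  refine ⟨k, ?_⟩
  have : (n : ℂ) ≠ 0 := by exact_mod_cast (by omega : n ≠ 0)
  field_simp

theorem mem_starShaped_iff {n : ℕ} {r : ℝ} {z : ℂ} :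
    z ∈ starShaped n r ↔ ∃ t : ℝ, ∃ u ∈ directions n, 0 ≤ t ∧ t < r ∧ z = t * u := by
  constructor
  · rintro ⟨t, k, h0, hr, hz⟩
    exact ⟨t, _, ⟨k, rfl⟩, h0, hr, hz⟩
  · rintro ⟨t, _, ⟨k, rfl⟩, h0, hr, hz⟩
    exact ⟨t, k, h0, hr, hz⟩

theorem norm_real_mul {n : ℕ} {u : ℂ} (hu : u ∈ directions n) {t : ℝ} (ht : 0 ≤ t) :
    ‖(t : ℂ) * u‖ = t := by
  rw [norm_mul, norm_of_mem_directions hu, Complex.norm_real, Real.norm_of_nonneg ht, mul_one]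

theorem sameRay_mul {u : ℂ} {s t : ℝ} (hs : 0 ≤ s) (ht : 0 ≤ t) :
    SameRay ℝ ((s : ℂ) * u) ((t : ℂ) * u) := by
  rw [← Complex.real_smul, ← Complex.real_smul]
  exact (SameRay.refl u).nonneg_smul_left hs |>.nonneg_smul_right ht

theorem eq_of_sameRay {n : ℕ} {u w : ℂ} (hu : u ∈ directions n) (hw : w ∈ directions n) {s t : ℝ}
    (hs : 0 < s) (ht : 0 < t) (h : SameRay ℝ ((s : ℂ) * u) ((t : ℂ) * w)) : u = w := by
  have h := h.norm_smul_eq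
  rw [norm_real_mul hu hs.le, norm_real_mul hw ht.le, Complex.real_smul, Complex.real_smul] at h
  have hs' : (s : ℂ) ≠ 0 := by exact_mod_cast hs.ne'
  have ht' : (t : ℂ) ≠ 0 := by exact_mod_cast ht.ne'
  have : (s : ℂ) * t * w = s * t * u := by linear_combination h
  exact (mul_left_cancel₀ (mul_ne_zero hs' ht') this).symm

theorem starDist_of_sameRay {z w : ℂ} (h : SameRay ℝ z w) : starDist z w = dist z w := by
  rw [starDist, if_pos h, dist_eq_norm]


/-- Off a common ray both points are nonzero, and then `‖z‖ + ‖w‖` exceeds `|‖z‖ - ‖w‖|`. The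
Euclidean metric has the same property by strict convexity, so both conventions recognize rays in
the same way. -/
theorem sameRay_of_starDist_eq {z w : ℂ} (h : starDist z w = |‖z‖ - ‖w‖|) : SameRay ℝ z w := by
  by_contra hn
  rw [starDist, if_neg hn] at h
  have hz : z ≠ 0 := fun h0 => hn (h0 ▸ SameRay.zero_left w)
  have hw : w ≠ 0 := fun h0 => hn (h0 ▸ SameRay.zero_right z)
  have h1 := norm_pos_iff.2 hz
  have h2 := norm_pos_iff.2 hw
  rcases abs_cases (‖z‖ - ‖w‖) with h3 | h3 <;> linarith [h3.1]

/-- A neighbourhood isometric to a star-shaped set, in terms of what the two metrics share. -/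
theorem HasValence.exists_chart {X : Type*} [MetricSpace X] {p : X} {n : ℕ} (h : HasValence p n) :
    ∃ r > 0, ∃ U ∈ 𝓝 p, ∃ φ : X → ℂ, BijOn φ U (starShaped n r) ∧ φ p = 0 ∧
      (∀ x ∈ U, ∀ y ∈ U, SameRay ℝ (φ x) (φ y) → dist x y = |‖φ x‖ - ‖φ y‖|) ∧
      (∀ x ∈ U, ∀ y ∈ U, dist x y = |‖φ x‖ - ‖φ y‖| → SameRay ℝ (φ x) (φ y)) := by
  obtain ⟨r, hr, U, hU, φ, hφ, h0, hd⟩ := h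
  refine ⟨r, hr, U, hU, φ, hφ, h0, ?_, ?_⟩
  · intro x hx y hy hs
    rcases hd with hd | hd
    · rw [hd x hx y hy, starDist_of_sameRay hs, dist_eq_norm, sameRay_iff_norm_sub.1 hs]
    · rw [hd x hx y hy, dist_eq_norm, sameRay_iff_norm_sub.1 hs]
  · intro x hx y hy hxy
    rcases hd with hd | hd
    · exact sameRay_of_starDist_eq ((hd x hx y hy).symm.trans hxy)
    · rw [hd x hx y hy, dist_eq_norm] at hxy
      exact sameRay_iff_norm_sub.2 hxy

theorem HasValence.exists_isStar {X : Type*} [MetricSpace X] {p : X} {n : ℕ} (h : HasValence p n) :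
    ∃ (ρ : directions n → ℝ → X) (ε : ℝ), IsStar p ρ ε := by
  obtain ⟨r, hr, U, hU, φ, hφ, h0, hd, hs⟩ := h.exists_chart
  obtain ⟨δ, hδ, hδU⟩ := Metric.mem_nhds_iff.1 hU
  have hp : p ∈ U := mem_of_mem_nhds hU
  have : Nonempty X := ⟨p⟩
  set ψ := Function.invFunOn φ U with hψ
  have hinv : InvOn ψ φ U (starShaped n r) := hφ.invOn_invFunOn
  have hmaps : MapsTo ψ (starShaped n r) U := hφ.surjOn.mapsTo_invFunOn
  -- Strictly below `r`, so that the closed rays of length `ε` lie in the star; strictly below `δ`,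
  -- so that the closed ball lies in `U`.
  set ε := min (r / 2) (δ / 2) with hε
  have hε0 : 0 < ε := by positivity
  have hεr : ε < r := (min_le_left _ _).trans_lt (by linarith)
  have hεδ : ε < δ := (min_le_right _ _).trans_lt (by linarith)
  have hmem : ∀ (u : directions n) (t : ℝ), t ∈ Icc 0 ε → (t : ℂ) * u ∈ starShaped n r :=
    fun u t ht => mem_starShaped_iff.2 ⟨t, u, u.2, ht.1, ht.2.trans_lt hεr, rfl⟩
  refine ⟨fun u t => ψ (t * u), ε, hε0, ?_, ?_, ?_, ?_⟩
  · intro u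
    rw [← hinv.1 hp, h0]; simp
  · intro u s hs t ht
    rw [hd _ (hmaps (hmem u s hs)) _ (hmaps (hmem u t ht)), hinv.2 (hmem u s hs),
      hinv.2 (hmem u t ht), norm_real_mul u.2 hs.1, norm_real_mul u.2 ht.1]
    rw [hinv.2 (hmem u s hs), hinv.2 (hmem u t ht)]
    exact sameRay_mul hs.1 ht.1
  · intro u w s hs' t ht' hst
    have hs1 : s ∈ Icc 0 ε := ⟨hs'.1.le, hs'.2⟩
    have ht1 : t ∈ Icc 0 ε := ⟨ht'.1.le, ht'.2⟩
    have := hs _ (hmaps (hmem u s hs1)) _ (hmaps (hmem w t ht1))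
    rw [hinv.2 (hmem u s hs1), hinv.2 (hmem w t ht1), norm_real_mul u.2 hs1.1,
      norm_real_mul w.2 ht1.1] at this
    exact Subtype.ext (eq_of_sameRay u.2 w.2 hs'.1 ht'.1 (this hst))
  · intro x hx
    have hxU : x ∈ U := hδU (hx.trans_lt hεδ)
    obtain ⟨t, u, hu, ht0, htr, hz⟩ := mem_starShaped_iff.1 (hφ.mapsTo hxU)
    have hxt : dist x p = t := by
      rw [hd x hxU p hp (by rw [h0]; exact SameRay.zero_right _), h0, hz, norm_real_mul hu ht0]
      simp [abs_of_nonneg ht0]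
    refine ⟨⟨u, hu⟩, ?_⟩
    rw [hxt]
    change x = ψ (t * u)
    rw [← hz, hinv.1 hxU]

/-- A line chart at `p`: an isometric segment of length `2 * ε` with midpoint `p` that contains the
closed ball of radius `ε`. -/
structure IsLineChart {X : Type*} [MetricSpace X] (p : X) (c : ℝ → X) (ε : ℝ) : Prop where
  pos : 0 < ε
  zero : c 0 = p
  isometryOn : IsometryOn c (Icc (-ε) ε)
  cover : ∀ x, dist x p ≤ ε → x ∈ c '' Icc (-ε) ε

theorem IsLineChart.shrink {X : Type*} [MetricSpace X] {p : X} {c : ℝ → X} {ε : ℝ}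
    (h : IsLineChart p c ε) {δ : ℝ} (hδ : 0 < δ) (hδε : δ ≤ ε) : IsLineChart p c δ := by
  refine ⟨hδ, h.zero, h.isometryOn.mono (Icc_subset_Icc (by linarith) hδε), ?_⟩
  intro x hx
  obtain ⟨t, ht, rfl⟩ := h.cover x (hx.trans hδε)
  refine ⟨t, ?_, rfl⟩
  rw [← h.zero, h.isometryOn t ht 0 ⟨by linarith [h.pos], h.pos.le⟩, sub_zero] at hx
  exact abs_le.1 hx

theorem mem_starShaped_two_iff {r : ℝ} {z : ℂ} :
    z ∈ starShaped 2 r ↔ ∃ t : ℝ, |t| < r ∧ z = t := by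
  have key : ∀ k : ℤ, Complex.exp (2 * (k : ℂ) * (Real.pi : ℂ) * Complex.I / ((2 : ℕ) : ℂ)) =
      (-1 : ℂ) ^ k := by
    intro k
    rw [← Complex.exp_pi_mul_I, ← Complex.exp_int_mul]
    congr 1
    push_cast
    ring
  constructor
  · rintro ⟨t, k, h0, hr, rfl⟩
    rw [key]
    rcases Int.even_or_odd k with hk | hk
    · exact ⟨t, by rwa [abs_of_nonneg h0], by rw [hk.neg_one_zpow, mul_one]⟩
    · exact ⟨-t, by rwa [abs_neg, abs_of_nonneg h0], by rw [hk.neg_one_zpow]; push_cast; ring⟩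
  · rintro ⟨t, ht, rfl⟩
    rcases le_total 0 t with h0 | h0
    · exact ⟨t, 0, h0, by rwa [abs_of_nonneg h0] at ht, by rw [key]; simp⟩
    · exact ⟨-t, 1, by linarith, by rwa [abs_of_nonpos h0] at ht, by rw [key]; simp⟩

theorem starDist_ofReal (s t : ℝ) : starDist (s : ℂ) (t : ℂ) = |s - t| := by
  have hsub : ‖(s : ℂ) - t‖ = |s - t| := by rw [← Complex.ofReal_sub, Complex.norm_real]; rfl
  by_cases h : SameRay ℝ (s : ℂ) (t : ℂ)
  · rw [starDist, if_pos h, hsub]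
  · rw [starDist, if_neg h, Complex.norm_real, Complex.norm_real, Real.norm_eq_abs, Real.norm_eq_abs]
    have hpos : ∀ a b : ℝ, 0 ≤ a → 0 ≤ b → SameRay ℝ (a : ℂ) (b : ℂ) := fun a b ha hb => by
      simpa using sameRay_mul (u := 1) ha hb
    have hneg : ∀ a b : ℝ, a ≤ 0 → b ≤ 0 → SameRay ℝ (a : ℂ) (b : ℂ) := fun a b ha hb => by
      simpa using (hpos (-a) (-b) (by linarith) (by linarith)).neg
    rcases le_total 0 s with hs | hs <;> rcases le_total 0 t with ht | ht
    · exact absurd (hpos s t hs ht) h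
    · rw [abs_of_nonneg hs, abs_of_nonpos ht, abs_of_nonneg] <;> linarith
    · rw [abs_of_nonpos hs, abs_of_nonneg ht, abs_of_nonpos] <;> linarith
    · exact absurd (hneg s t hs ht) h

/-- The star of valence `2` is a real interval, on which the path metric and the induced metric are
both `|s - t|`; hence the convention plays no role here. -/
theorem hasValence_two_iff {X : Type*} [MetricSpace X] {p : X} :
    HasValence p 2 ↔ ∃ c ε, IsLineChart p c ε := by
  constructor
  · rintro ⟨r, hr, U, hU, φ, hφ, h0, hd⟩
    obtain ⟨δ, hδ, hδU⟩ := Metric.mem_nhds_iff.1 hU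
    have hp : p ∈ U := mem_of_mem_nhds hU
    have : Nonempty X := ⟨p⟩
    have hd' : ∀ x ∈ U, ∀ y ∈ U, ∀ s t : ℝ, φ x = s → φ y = t → dist x y = |s - t| := by
      intro x hx y hy s t hs ht
      rcases hd with hd | hd
      · rw [hd x hx y hy, hs, ht, starDist_ofReal]
      · rw [hd x hx y hy, hs, ht, dist_eq_norm, ← Complex.ofReal_sub, Complex.norm_real]; rfl
    set ψ := Function.invFunOn φ U
    have hinv : InvOn ψ φ U (starShaped 2 r) := hφ.invOn_invFunOn
    have hmaps : MapsTo ψ (starShaped 2 r) U := hφ.surjOn.mapsTo_invFunOn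
    set ε := min (r / 2) (δ / 2) with hε
    have hε0 : 0 < ε := by positivity
    have hεr : ε < r := (min_le_left _ _).trans_lt (by linarith)
    have hεδ : ε < δ := (min_le_right _ _).trans_lt (by linarith)
    have hmem : ∀ t : ℝ, t ∈ Icc (-ε) ε → (t : ℂ) ∈ starShaped 2 r :=
      fun t ht => mem_starShaped_two_iff.2 ⟨t, (abs_le.2 ht).trans_lt hεr, rfl⟩
    refine ⟨fun t => ψ t, ε, hε0, ?_, ?_, ?_⟩
    · rw [← hinv.1 hp, h0]; simp
    · intro s hs t ht
      exact hd' _ (hmaps (hmem s hs)) _ (hmaps (hmem t ht)) _ _ (hinv.2 (hmem s hs))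
        (hinv.2 (hmem t ht))
    · intro x hx
      have hxU : x ∈ U := hδU (hx.trans_lt hεδ)
      obtain ⟨t, ht, hxt⟩ := mem_starShaped_two_iff.1 (hφ.mapsTo hxU)
      refine ⟨t, abs_le.1 ?_, by rw [← hinv.1 hxU, hxt]⟩
      rwa [hd' x hxU p hp t 0 hxt (by simpa using h0), sub_zero] at hx
  · rintro ⟨c, ε, hε, h0, hc, hcov⟩
    have hinj : InjOn c (Icc (-ε) ε) := hc.injOn
    have hz : (0 : ℝ) ∈ Icc (-ε) ε := ⟨by linarith, hε.le⟩
    set ψ := Function.invFunOn c (Icc (-ε) ε)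
    have hψ : ∀ t ∈ Icc (-ε) ε, ψ (c t) = t := fun t ht => hinj.leftInvOn_invFunOn ht
    have hball : ∀ x ∈ Metric.ball p ε, ∃ t, |t| < ε ∧ x = c t ∧ ψ x = t := by
      intro x hx
      obtain ⟨t, ht, rfl⟩ := hcov x (le_of_lt hx)
      rw [Metric.mem_ball, ← h0, hc t ht 0 hz, sub_zero] at hx
      exact ⟨t, hx, rfl, hψ t ht⟩
    have hdist : ∀ x ∈ Metric.ball p ε, ∀ y ∈ Metric.ball p ε, dist x y = |ψ x - ψ y| := by
      intro x hx y hy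
      obtain ⟨s, hs, rfl, hs'⟩ := hball x hx
      obtain ⟨t, ht, rfl, ht'⟩ := hball y hy
      rw [hs', ht', hc s (abs_le.1 hs.le) t (abs_le.1 ht.le)]
    refine ⟨ε, hε, Metric.ball p ε, Metric.ball_mem_nhds p hε, fun x => ((ψ x : ℝ) : ℂ), ?_, ?_,
      Or.inl ?_⟩
    · refine ⟨?_, ?_, ?_⟩
      · intro x hx
        obtain ⟨t, ht, -, ht'⟩ := hball x hx
        exact mem_starShaped_two_iff.2 ⟨ψ x, by rwa [ht'], rfl⟩
      · intro x hx y hy hxy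
        have := hdist x hx y hy
        rw [Complex.ofReal_inj.1 hxy, sub_self, abs_zero] at this
        exact dist_eq_zero.1 this
      · intro z hz'
        obtain ⟨t, ht, rfl⟩ := mem_starShaped_two_iff.1 hz'
        have ht' := abs_le.1 ht.le
        refine ⟨c t, ?_, by simp only [hψ t ht']⟩
        rwa [Metric.mem_ball, ← h0, hc t ht' 0 hz, sub_zero]
    · have := hψ 0 hz
      rw [h0] at this
      simp [this]
    · intro x hx y hy
      rw [hdist x hx y hy, starDist_ofReal]

theorem IsStar.dist_center {X I : Type*} [MetricSpace X] {p : X} {ρ : I → ℝ → X} {ε : ℝ}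
    (h : IsStar p ρ ε) (u : I) {t : ℝ} (ht : t ∈ Icc 0 ε) : dist (ρ u t) p = t := by
  rw [← h.zero u, h.isometryOn u t ht 0 ⟨le_rfl, h.pos.le⟩, sub_zero, abs_of_nonneg ht.1]

/-- The open ray is what remains of the open ball after removing the centre and the finitely many
other closed rays, which are compact. -/
theorem IsStar.isOpen_ray {X I : Type*} [MetricSpace X] [Finite I] {p : X} {ρ : I → ℝ → X} {ε : ℝ}
    (h : IsStar p ρ ε) (u : I) : IsOpen (ρ u '' Ioo 0 ε) := by
  have heq : ρ u '' Ioo 0 ε =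
      Metric.ball p ε \ ({p} ∪ ⋃ w ∈ {w | w ≠ u}, ρ w '' Icc 0 ε) := by
    ext x
    constructor
    · rintro ⟨t, ht, rfl⟩
      have hd := h.dist_center u (Ioo_subset_Icc_self ht)
      refine ⟨by rw [Metric.mem_ball, hd]; exact ht.2, ?_⟩
      rintro (hp | hp)
      · rw [mem_singleton_iff.1 hp, dist_self] at hd
        exact ht.1.ne hd
      · simp only [mem_iUnion, mem_image] at hp
        obtain ⟨w, hw, s, hs, hst⟩ := hp
        have hd' := h.dist_center w hs
        rw [hst, hd] at hd'
        subst hd'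
        refine hw (h.ray_eq w u t ⟨ht.1, hs.2⟩ t ⟨ht.1, hs.2⟩ ?_)
        rw [hst, dist_self, sub_self, abs_zero]
    · rintro ⟨hx, hn⟩
      rw [Metric.mem_ball] at hx
      obtain ⟨w, hw⟩ := h.cover x hx.le
      have hwu : w = u := by
        by_contra hne
        refine hn (Or.inr ?_)
        simp only [mem_iUnion]
        exact ⟨w, hne, dist x p, ⟨dist_nonneg, hx.le⟩, hw.symm⟩
      subst hwu
      refine ⟨dist x p, ⟨dist_pos.2 fun hxp => hn (Or.inl hxp), hx⟩, hw.symm⟩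
  rw [heq]
  refine Metric.isOpen_ball.sdiff (isClosed_singleton.union ?_)
  refine (toFinite _).isClosed_biUnion fun w _ => ?_
  exact (isCompact_Icc.image_of_continuousOn (h.isometryOn w).continuousOn).isClosed

/-! ### Subdivisions into isometric segments -/

/-- `e` is an open segment of a subdivision with vertex set `V`: the interior of the isometric
segment `γ` from `γ s ∈ V` to `γ t ∈ V`. -/
structure IsSegment {X : Type*} [MetricSpace X] (V e : Set X) (γ : ℝ → X) (s t : ℝ) : Prop where
  lt : s < t
  isometryOn : IsometryOn γ (Icc s t)
  left_mem : γ s ∈ V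
  right_mem : γ t ∈ V
  eq : e = γ '' Ioo s t
  isOpen : IsOpen e
  disjoint : Disjoint e V

/-- The open segments of a subdivision with vertex set `V`. -/
def edgesOf {X : Type*} [MetricSpace X] (V : Set X) : Set (Set X) :=
  {e | ∃ γ s t, IsSegment V e γ s t}

/-- `V` is the vertex set of a finite subdivision of `X` into isometric segments. -/
structure IsSubdivision {X : Type*} [MetricSpace X] (V : Set X) : Prop where
  finite : V.Finite
  finite_edges : (edgesOf V).Finite
  cover : Vᶜ ⊆ ⋃₀ edgesOf V

section Segment

variable {X : Type*} [MetricSpace X] {V e e' : Set X} {γ : ℝ → X} {s t : ℝ}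

theorem IsSegment.isPreconnected (h : IsSegment V e γ s t) : IsPreconnected e := by
  rw [h.eq]
  exact isPreconnected_Ioo.image _ (h.isometryOn.continuousOn.mono Ioo_subset_Icc_self)

theorem IsSegment.nonempty (h : IsSegment V e γ s t) : e.Nonempty := by
  rw [h.eq]
  exact (nonempty_Ioo.2 h.lt).image _

theorem IsSegment.image_Icc (h : IsSegment V e γ s t) : γ '' Icc s t = e ∪ {γ s, γ t} := by
  rw [h.eq, ← Ioo_union_both h.lt.le, image_union, image_pair]

theorem IsSegment.closure_eq (h : IsSegment V e γ s t) : closure e = e ∪ {γ s, γ t} := by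
  apply subset_antisymm
  · rw [← h.image_Icc]
    refine closure_minimal ?_ (isCompact_Icc.image_of_continuousOn h.isometryOn.continuousOn).isClosed
    rw [h.eq]
    exact image_mono Ioo_subset_Icc_self
  · rw [← h.image_Icc, ← closure_Ioo h.lt.ne, h.eq]
    exact ContinuousOn.image_closure (by rw [closure_Ioo h.lt.ne]; exact h.isometryOn.continuousOn)

/-- A segment is connected and contains no vertex, while the other one is open with only vertices in
its frontier; so a segment that enters another cannot leave it. The edges are therefore determined
by `V` alone. -/
theorem eq_of_mem_edgesOf (he : e ∈ edgesOf V) (he' : e' ∈ edgesOf V) (hee : (e ∩ e').Nonempty) :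
    e = e' := by
  have key : ∀ {e e' : Set X}, e ∈ edgesOf V → e' ∈ edgesOf V → (e ∩ e').Nonempty → e ⊆ e' := by
    rintro e e' ⟨γ, s, t, h⟩ ⟨γ', s', t', h'⟩ hee
    refine h.isPreconnected.subset_of_closure_inter_subset h'.isOpen hee ?_
    rw [h'.closure_eq]
    rintro x ⟨hx | hx | hx, hxe⟩
    · exact hx
    · exact absurd (hx ▸ h'.left_mem) (disjoint_left.1 h.disjoint hxe)
    · exact absurd (mem_singleton_iff.1 hx ▸ h'.right_mem) (disjoint_left.1 h.disjoint hxe)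
  exact (key he he' hee).antisymm (key he' he (inter_comm e e' ▸ hee))

/-- A point of an open segment has valence `2`. -/
theorem IsSegment.hasValence (h : IsSegment V e γ s t) {x : X} (hx : x ∈ e) : HasValence x 2 := by
  have hx' := hx
  rw [h.eq] at hx'
  obtain ⟨x₀, hx₀, rfl⟩ := hx'
  obtain ⟨δ, hδ, hδe⟩ := Metric.isOpen_iff.1 h.isOpen _ hx
  set ε := min (δ / 2) (min (x₀ - s) (t - x₀)) with hε
  have h1 : 0 < x₀ - s := by linarith [hx₀.1]
  have h2 : 0 < t - x₀ := by linarith [hx₀.2]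
  have hε0 : 0 < ε := by positivity
  have hεδ : ε < δ := (min_le_left _ _).trans_lt (by linarith)
  have hεs : ε ≤ x₀ - s := (min_le_right _ _).trans (min_le_left _ _)
  have hεt : ε ≤ t - x₀ := (min_le_right _ _).trans (min_le_right _ _)
  refine hasValence_two_iff.2 ⟨fun τ => γ (x₀ + τ), ε, hε0, by simp, ?_, ?_⟩
  · intro a ha b hb
    rw [h.isometryOn (x₀ + a) ⟨by linarith [ha.1], by linarith [ha.2]⟩ (x₀ + b)
      ⟨by linarith [hb.1], by linarith [hb.2]⟩]
    congr 1
    ring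
  · intro y hy
    have hye : y ∈ e := hδe (hy.trans_lt hεδ)
    rw [h.eq] at hye
    obtain ⟨y₀, hy₀, rfl⟩ := hye
    rw [h.isometryOn y₀ (Ioo_subset_Icc_self hy₀) x₀ (Ioo_subset_Icc_self hx₀)] at hy
    refine ⟨y₀ - x₀, abs_le.1 hy, ?_⟩
    simp

theorem IsSubdivision.vertexSet_subset (h : IsSubdivision V) : vertexSet X ⊆ V := by
  intro x hx
  by_contra hxV
  obtain ⟨e, ⟨γ, s, t, he⟩, hxe⟩ := h.cover hxV
  exact hx (he.hasValence hxe)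

/-- A union of vertices and edges is open if it contains every edge that ends in one of the
vertices. -/
theorem IsSubdivision.isOpen_union (h : IsSubdivision V) {W : Set X} {F : Set (Set X)}
    (hF : F ⊆ edgesOf V) (hWF : ∀ e ∈ edgesOf V, (closure e ∩ W).Nonempty → e ∈ F) :
    IsOpen (W ∪ ⋃₀ F) := by
  -- The complement is a finite union of closed sets: the other vertices and the closures of the
  -- other edges, which by assumption do not reach `W`.
  have heq : W ∪ ⋃₀ F = ((V \ W) ∪ ⋃ e ∈ edgesOf V \ F, closure e)ᶜ := by
    ext x
    constructor
    · rintro hx (hxV | hxe)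
      · rcases hx with hx | ⟨e, he, hxe⟩
        · exact hxV.2 hx
        · obtain ⟨γ, s, t, hs⟩ := hF he
          exact disjoint_left.1 hs.disjoint hxe hxV.1
      · simp only [mem_iUnion] at hxe
        obtain ⟨e, he, hxe⟩ := hxe
        rcases hx with hx | ⟨e', he', hxe'⟩
        · exact he.2 (hWF e he.1 ⟨x, hxe, hx⟩)
        · obtain ⟨γ, s, t, hs⟩ := hF he'
          have : (e' ∩ e).Nonempty := by
            obtain ⟨y, hy⟩ := mem_closure_iff.1 hxe e' hs.isOpen hxe'
            exact ⟨y, hy⟩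
          exact he.2 (eq_of_mem_edgesOf (hF he') he.1 this ▸ he')
    · intro hx
      by_cases hxV : x ∈ V
      · by_contra hxn
        exact hx (Or.inl ⟨hxV, fun hxW => hxn (Or.inl hxW)⟩)
      · obtain ⟨e, he, hxe⟩ := h.cover hxV
        by_contra hxn
        refine hx (Or.inr ?_)
        simp only [mem_iUnion]
        exact ⟨e, ⟨he, fun heF => hxn (Or.inr ⟨e, heF, hxe⟩)⟩, subset_closure hxe⟩
  rw [heq, isOpen_compl_iff]
  exact (h.finite.subset sdiff_subset).isClosed.union
    ((h.finite_edges.subset sdiff_subset).isClosed_biUnion fun e _ => isClosed_closure)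

end Segment

/-! ### Existence of an invariant subdivision -/

/-- A finite family of isometric arcs with open interiors that cover the complement of `V`. -/
structure IsArcFamily {X : Type*} [MetricSpace X] (V : Set X) (A : Set ((ℝ → X) × ℝ)) : Prop where
  finite : A.Finite
  isometryOn : ∀ a ∈ A, IsometryOn a.1 (Icc 0 a.2)
  left_mem : ∀ a ∈ A, a.1 0 ∈ V
  right_mem : ∀ a ∈ A, a.1 a.2 ∈ V
  isOpen : ∀ a ∈ A, IsOpen (a.1 '' Ioo 0 a.2)
  cover : ∀ x ∉ V, ∃ a ∈ A, x ∈ a.1 '' Ioo 0 a.2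

theorem IsArcFamily.mono {X : Type*} [MetricSpace X] {V W : Set X} {A : Set ((ℝ → X) × ℝ)}
    (h : IsArcFamily V A) (hVW : V ⊆ W) : IsArcFamily W A :=
  ⟨h.finite, h.isometryOn, fun a ha => hVW (h.left_mem a ha), fun a ha => hVW (h.right_mem a ha),
    h.isOpen, fun x hx => h.cover x fun hxV => hx (hVW hxV)⟩

/-- Cut every arc at its points in `V`. The arcs may overlap: pieces that meet coincide by
`eq_of_mem_edgesOf`. This freedom is what allows `V` to be enlarged arbitrarily afterwards. -/
theorem IsArcFamily.isSubdivision {X : Type*} [MetricSpace X] {V : Set X}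
    {A : Set ((ℝ → X) × ℝ)} (h : IsArcFamily V A) (hV : V.Finite) : IsSubdivision V := by
  have hT : ∀ a ∈ A, (Icc 0 a.2 ∩ a.1 ⁻¹' V).Finite := fun a ha =>
    Finite.of_finite_image (hV.subset (by rintro _ ⟨x, hx, rfl⟩; exact hx.2))
      ((h.isometryOn a ha).injOn.mono inter_subset_left)
  -- A finite stock of sets that contains all edges: the pieces of the arcs between two parameters
  -- of points of `V`.
  set G : Set (Set X) := ⋃ a ∈ A, (fun q : ℝ × ℝ => a.1 '' Ioo q.1 q.2) ''
    ((Icc 0 a.2 ∩ a.1 ⁻¹' V) ×ˢ (Icc 0 a.2 ∩ a.1 ⁻¹' V)) with hG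
  have hGf : G.Finite := h.finite.biUnion fun a ha => ((hT a ha).prod (hT a ha)).image _
  have key : ∀ x ∉ V, ∃ e ∈ edgesOf V, e ∈ G ∧ x ∈ e := by
    intro x hx
    obtain ⟨a, ha, x₀, hx₀, rfl⟩ := h.cover x hx
    obtain ⟨γ, l⟩ := a
    simp only at hx₀ hx
    have hl : 0 < l := hx₀.1.trans hx₀.2
    have hfin := hT _ ha
    have hiso := h.isometryOn _ ha
    have hop := h.isOpen _ ha
    simp only at hfin hiso hop
    set T := Icc 0 l ∩ γ ⁻¹' V with hTdef
    -- The cut points nearest to `x₀` on either side bound the edge through `x`.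
    obtain ⟨s, ⟨hsT, hsx⟩, hs⟩ := exists_max_image (T ∩ Iio x₀) id (hfin.subset inter_subset_left)
      ⟨0, ⟨⟨le_rfl, hl.le⟩, h.left_mem _ ha⟩, hx₀.1⟩
    obtain ⟨t, ⟨htT, htx⟩, ht⟩ := exists_min_image (T ∩ Ioi x₀) id (hfin.subset inter_subset_left)
      ⟨l, ⟨⟨hl.le, le_rfl⟩, h.right_mem _ ha⟩, hx₀.2⟩
    simp only [mem_Iio, mem_Ioi, id] at hsx htx hs ht
    have hsub : Icc s t ⊆ Icc 0 l := Icc_subset_Icc hsT.1.1 htT.1.2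
    refine ⟨γ '' Ioo s t, ⟨γ, s, t, hsx.trans htx, hiso.mono hsub, hsT.2, htT.2, rfl, ?_, ?_⟩, ?_,
      ⟨x₀, ⟨hsx, htx⟩, rfl⟩⟩
    · have heq : γ '' Ioo s t = γ '' Ioo 0 l \ (γ '' Icc 0 s ∪ γ '' Icc t l) := by
        have h1 : Ioo s t = Ioo 0 l \ (Icc 0 s ∪ Icc t l) := by
          ext y
          simp only [mem_Ioo, mem_sdiff, mem_union, mem_Icc, not_or, not_and, not_le]
          constructor
          · rintro ⟨h1, h2⟩
            exact ⟨⟨hsT.1.1.trans_lt h1, h2.trans_le htT.1.2⟩, fun _ => h1,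
              fun h3 => absurd h2 h3.not_gt⟩
          · rintro ⟨⟨h1, h2⟩, h3, h4⟩
            exact ⟨h3 h1.le, lt_of_not_ge fun h5 => absurd h2 (h4 h5).not_gt⟩
        have hs' : Icc 0 s ⊆ Icc 0 l := Icc_subset_Icc le_rfl hsT.1.2
        have ht' : Icc t l ⊆ Icc 0 l := Icc_subset_Icc htT.1.1 le_rfl
        rw [h1, ← image_union]
        refine Subset.antisymm ?_
          (by rintro _ ⟨⟨y, hy, rfl⟩, hn⟩; exact ⟨y, ⟨hy, fun h => hn ⟨y, h, rfl⟩⟩, rfl⟩)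
        rintro _ ⟨y, ⟨hy, hn⟩, rfl⟩
        refine ⟨⟨y, hy, rfl⟩, ?_⟩
        rintro ⟨z, hz, hzy⟩
        exact hn (hiso.injOn (union_subset hs' ht' hz) (Ioo_subset_Icc_self hy) hzy ▸ hz)
      rw [heq]
      refine hop.sdiff (IsClosed.union ?_ ?_)
      · exact (isCompact_Icc.image_of_continuousOn
          (hiso.mono (Icc_subset_Icc le_rfl hsT.1.2)).continuousOn).isClosed
      · exact (isCompact_Icc.image_of_continuousOn
          (hiso.mono (Icc_subset_Icc htT.1.1 le_rfl)).continuousOn).isClosed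
    · rw [disjoint_left]
      rintro _ ⟨y, hy, rfl⟩ hyV
      have hyT : y ∈ T := ⟨hsub (Ioo_subset_Icc_self hy), hyV⟩
      rcases lt_trichotomy y x₀ with hyx | rfl | hyx
      · exact absurd (hs y ⟨hyT, hyx⟩) hy.1.not_ge
      · exact hx hyV
      · exact absurd (ht y ⟨hyT, hyx⟩) hy.2.not_ge
    · rw [hG]
      exact mem_biUnion ha ⟨(s, t), ⟨hsT, htT⟩, rfl⟩
  refine ⟨hV, hGf.subset ?_, ?_⟩
  · rintro e ⟨γ, s, t, he⟩
    obtain ⟨x, hx⟩ := he.nonempty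
    obtain ⟨e', he', heG, hxe⟩ := key x (disjoint_left.1 he.disjoint hx)
    rwa [eq_of_mem_edgesOf ⟨γ, s, t, he⟩ he' ⟨x, hx, hxe⟩]
  · intro x hx
    obtain ⟨e, he, -, hxe⟩ := key x hx
    exact ⟨e, he, hxe⟩

theorem IsMetricGraph.exists_isStar {Γ : Type*} [MetricSpace Γ] (hΓ : IsMetricGraph Γ) (p : Γ) :
    ∃ (n : ℕ) (_ : 1 ≤ n) (ρ : directions n → ℝ → Γ) (ε : ℝ), IsStar p ρ ε := by
  obtain ⟨n, hn, h⟩ := hΓ.star p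
  exact ⟨n, hn, h.exists_isStar⟩

/-- By compactness finitely many stars cover `Γ`; their rays are the arcs, and `V` consists of the
centres and the outer ends of the rays. -/
theorem IsMetricGraph.exists_isArcFamily {Γ : Type*} [MetricSpace Γ] (hΓ : IsMetricGraph Γ) :
    ∃ (V : Set Γ) (A : Set ((ℝ → Γ) × ℝ)), V.Finite ∧ IsArcFamily V A := by
  have := hΓ.compact
  choose n hn ρ ε h using hΓ.exists_isStar
  have hfin : ∀ p, Finite (directions (n p)) := fun p => (finite_directions (hn p)).to_subtype
  obtain ⟨T, hT⟩ := CompactSpace.elim_nhds_subcover (fun p => Metric.ball p (ε p))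
    fun p => Metric.ball_mem_nhds p (h p).pos
  set V : Set Γ := ⋃ p ∈ (T : Set Γ), insert p (range fun u => ρ p u (ε p)) with hV
  refine ⟨V, ⋃ p ∈ (T : Set Γ), range fun u => (ρ p u, ε p), ?_, ?_, ?_, ?_, ?_, ?_, ?_⟩
  · exact T.finite_toSet.biUnion fun p _ => (finite_range _).insert p
  · exact T.finite_toSet.biUnion fun p _ => finite_range _
  all_goals
    try
      intro a ha
      simp only [mem_iUnion, mem_range] at ha
      obtain ⟨p, hp, u, rfl⟩ := ha
  · exact (h p).isometryOn u
  · rw [show (ρ p u, ε p).1 0 = p from (h p).zero u]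
    exact mem_biUnion hp (mem_insert _ _)
  · exact mem_biUnion hp (mem_insert_of_mem _ ⟨u, rfl⟩)
  · exact (h p).isOpen_ray u
  · intro x hx
    have hxT : x ∈ ⋃ p ∈ T, Metric.ball p (ε p) := hT ▸ mem_univ x
    simp only [mem_iUnion] at hxT
    obtain ⟨p, hp, hxp⟩ := hxT
    rw [Metric.mem_ball] at hxp
    obtain ⟨u, hu⟩ := (h p).cover x hxp.le
    refine ⟨(ρ p u, ε p), mem_biUnion hp ⟨u, rfl⟩, dist x p, ⟨dist_pos.2 ?_, hxp⟩, hu.symm⟩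
    rintro rfl
    exact hx (mem_biUnion hp (mem_insert _ _))

theorem IsRealStructure.isClosed_realLocus {Γ : Type*} [MetricSpace Γ] {ι : Γ → Γ}
    (hι : IsRealStructure ι) : IsClosed (realLocus ι) :=
  isClosed_eq hι.isometry.continuous continuous_id

/-- A real point `q ≠ p` of the ball makes its whole open ray real, and this ray is open; so `q` is
an interior point of the real locus. -/
theorem IsStar.frontier_realLocus_subset {X I : Type*} [MetricSpace X] [Finite I] {p : X}
    {ρ : I → ℝ → X} {ε : ℝ} (h : IsStar p ρ ε) {ι : X → X} (hι : IsRealStructure ι)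
    (hp : p ∈ realLocus ι) : Metric.ball p ε ∩ frontier (realLocus ι) ⊆ {p} := by
  rintro q ⟨hq, hqf⟩
  by_contra hqp
  rw [Metric.mem_ball] at hq
  have hqR : q ∈ realLocus ι := hι.isClosed_realLocus.frontier_subset hqf
  obtain ⟨u, hu⟩ := h.cover q hq.le
  have hq0 : 0 < dist q p := dist_pos.2 hqp
  have hray : ρ u '' Ioo 0 ε ⊆ realLocus ι := by
    rintro _ ⟨t, ht, rfl⟩
    have hd := h.dist_center u (Ioo_subset_Icc_self ht)
    have hd' : dist (ι (ρ u t)) p = t := by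
      have hdι := hι.isometry.dist_eq (ρ u t) p
      rwa [show ι p = p from hp, hd] at hdι
    obtain ⟨w, hw⟩ := h.cover (ι (ρ u t)) (hd'.trans_le ht.2.le)
    rw [hd'] at hw
    -- The image point has the same distances from `p` and `q` as the original, since both are real.
    -- The distance from `p` gives the parameter `t`, and the distance from `q` gives the ray.
    have hwu : w = u := by
      refine h.ray_eq w u t ⟨ht.1, ht.2.le⟩ (dist q p) ⟨hq0, hq.le⟩ ?_
      have hdι := hι.isometry.dist_eq (ρ u t) q
      have hdu := h.isometryOn u t (Ioo_subset_Icc_self ht) _ ⟨hq0.le, hq.le⟩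
      rw [← hu] at hdu
      rw [← hw, ← hu, ← hdu, ← hdι, show ι q = q from hqR]
    change ι (ρ u t) = ρ u t
    rw [hw, hwu]
  have : q ∈ interior (realLocus ι) :=
    mem_interior.2 ⟨_, hray, h.isOpen_ray u, dist q p, ⟨hq0, hq⟩, hu.symm⟩
  exact hqf.2 this

theorem IsMetricGraph.finite_frontier_realLocus {Γ : Type*} [MetricSpace Γ] (hΓ : IsMetricGraph Γ)
    {ι : Γ → Γ} (hι : IsRealStructure ι) : (frontier (realLocus ι)).Finite := by
  have := hΓ.compact
  have key : ∀ p, ∃ U ∈ 𝓝 p, U ∩ frontier (realLocus ι) ⊆ {p} := by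
    intro p
    by_cases hp : p ∈ realLocus ι
    · obtain ⟨n, hn, ρ, ε, h⟩ := hΓ.exists_isStar p
      have := (finite_directions hn).to_subtype
      exact ⟨_, Metric.ball_mem_nhds p h.pos, h.frontier_realLocus_subset hι hp⟩
    · refine ⟨_, hι.isClosed_realLocus.isOpen_compl.mem_nhds hp, ?_⟩
      rintro q ⟨hq, hqf⟩
      exact absurd (hι.isClosed_realLocus.frontier_subset hqf) hq
  choose U hU hUf using key
  obtain ⟨T, hT⟩ := CompactSpace.elim_nhds_subcover U hU
  refine T.finite_toSet.subset fun q hq => ?_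
  have hqT : q ∈ ⋃ p ∈ T, U p := hT ▸ mem_univ q
  simp only [mem_iUnion] at hqT
  obtain ⟨p, hp, hqp⟩ := hqT
  rw [mem_singleton_iff.1 (hUf p ⟨hqp, hq⟩)]
  exact hp

theorem IsRealStructure.image_image {Γ : Type*} [MetricSpace Γ] {ι : Γ → Γ}
    (hι : IsRealStructure ι) (s : Set Γ) : ι '' (ι '' s) = s := by
  rw [← image_comp, hι.involutive.comp_self, image_id]

/-- A metric graph with a real structure has an invariant subdivision that is fine enough for every
segment to lie in the real locus or outside it. -/
theorem IsMetricGraph.exists_isSubdivision {Γ : Type*} [MetricSpace Γ] (hΓ : IsMetricGraph Γ)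
    {ι : Γ → Γ} (hι : IsRealStructure ι) :
    ∃ V : Set Γ, IsSubdivision V ∧ ι '' V = V ∧ frontier (realLocus ι) ⊆ V := by
  obtain ⟨V, A, hV, hA⟩ := hΓ.exists_isArcFamily
  refine ⟨(V ∪ ι '' V) ∪ frontier (realLocus ι), ?_, ?_, subset_union_right⟩
  · exact (hA.mono (subset_union_left.trans subset_union_left)).isSubdivision
      ((hV.union (hV.image _)).union (hΓ.finite_frontier_realLocus hι))
  · have hfix : ι '' frontier (realLocus ι) = frontier (realLocus ι) := by
      have : EqOn ι id (frontier (realLocus ι)) := fun x hx =>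
        hι.isClosed_realLocus.frontier_subset hx
      rw [this.image_eq, image_id]
    rw [image_union, image_union, hι.image_image, hfix, union_comm (ι '' V) V]

/-! ### Open arcs and their ends -/

section Ends

open Filter

/-- Invariance of domain in dimension one, for maps into a space with charts. -/
theorem isOpenEmbedding_of_forall_mem_range {X : Type*} [TopologicalSpace X] {g : ℝ → X}
    (hg : Continuous g) (hinj : Function.Injective g)
    (hc : ∀ x, ∃ c : ℝ → X, IsOpenEmbedding c ∧ g x ∈ range c) : IsOpenEmbedding g := by
  refine .of_continuous_injective_isOpenMap hg hinj (isOpenMap_iff_nhds_le.2 fun x W hW => ?_)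
  obtain ⟨c, hc, hx⟩ := hc x
  have hU : g ⁻¹' range c ∩ g ⁻¹' W ∈ 𝓝 x :=
    inter_mem ((hc.isOpen_range.preimage hg).mem_nhds hx) hW
  obtain ⟨δ, hδ, hδU⟩ := Metric.nhds_basis_closedBall.mem_iff.1 hU
  rw [Real.closedBall_eq_Icc] at hδU
  set I := Icc (x - δ) (x + δ) with hI
  have hxI : x ∈ I := ⟨by linarith, by linarith⟩
  -- In the chart `c`, the map `g` becomes a continuous injection between real intervals, which is
  -- strictly monotone.
  set ψ : ℝ → ℝ := fun y => Function.invFun c (g y) with hψ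
  have hcψ : ∀ y ∈ I, c (ψ y) = g y := fun y hy => Function.invFun_eq (hδU hy).1
  have hψc : ContinuousOn ψ I := by
    rw [hc.isInducing.continuousOn_iff]
    exact hg.continuousOn.congr hcψ
  have hψi : InjOn ψ I := fun y hy z hz h => hinj (by rw [← hcψ y hy, ← hcψ z hz, h])
  have hmem : ψ '' I ∈ 𝓝 (ψ x) := by
    have hl : x - δ ∈ I := ⟨le_rfl, by linarith⟩
    have hr : x + δ ∈ I := ⟨by linarith, le_rfl⟩
    rcases hψc.strictMonoOn_of_injOn_Icc' (by linarith) hψi with hm | hm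
    · exact mem_of_superset (Icc_mem_nhds (hm hl hxI (by linarith)) (hm hxI hr (by linarith)))
        (intermediate_value_Icc (by linarith) hψc)
    · exact mem_of_superset (Icc_mem_nhds (hm hxI hr (by linarith)) (hm hl hxI (by linarith)))
        (intermediate_value_Icc' (by linarith) hψc)
  have := hc.isOpenMap.image_mem_nhds hmem
  rw [hcψ x hxI] at this
  refine mem_of_superset this ?_
  rintro _ ⟨_, ⟨y, hy, rfl⟩, rfl⟩
  rw [hcψ y hy]
  exact (hδU hy).2

/-- Approaching `c 0` along the half-line, the monotone parameter `φ` on the arc tends to `-∞` or to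
a finite limit `l`. In the latter case `f l = c 0`, although `c 0` is not on the arc. -/
theorem tendsto_atBot_of_strictMono {X : Type*} [TopologicalSpace X] [T2Space X] {f c : ℝ → X}
    (hf : Continuous f) (hc : Continuous c) (h0 : c 0 ∉ range f) {φ : ℝ → ℝ} (hφ : Continuous φ)
    (hfφ : ∀ s, f (φ s) = c (Real.exp s)) (hmono : StrictMono φ) :
    Tendsto f atBot (𝓝 (c 0)) ∧ ∀ᶠ t in atBot, f t ∈ c '' Ioi 0 := by
  have hlim : Tendsto (fun s => c (Real.exp s)) atBot (𝓝 (c 0)) :=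
    (hc.tendsto 0).comp Real.tendsto_exp_atBot
  have hbot : Tendsto φ atBot atBot := by
    rcases tendsto_atBot_of_monotone hmono.monotone with h | ⟨l, hl⟩
    · exact h
    · refine absurd ⟨l, tendsto_nhds_unique ((hf.tendsto l).comp hl) ?_⟩ h0
      exact hlim.congr fun s => (hfφ s).symm
  have hivt : ∀ s₀, ∀ t ≤ φ s₀, ∃ s ≤ s₀, φ s = t := by
    intro s₀ t ht
    obtain ⟨s₁, hs₁, hs₁t⟩ := ((eventually_le_atBot s₀).and (hbot.eventually_le_atBot t)).exists
    obtain ⟨s, hs, hst⟩ := intermediate_value_Icc hs₁ hφ.continuousOn ⟨hs₁t, ht⟩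
    exact ⟨s, hs.2, hst⟩
  constructor
  · refine tendsto_def.2 fun W hW => ?_
    obtain ⟨s₀, hs₀⟩ := eventually_atBot.1 (hlim.eventually hW)
    filter_upwards [eventually_le_atBot (φ s₀)] with t ht
    obtain ⟨s, hs, rfl⟩ := hivt s₀ t ht
    rw [mem_preimage, hfφ]
    exact hs₀ s hs
  · filter_upwards [eventually_le_atBot (φ 0)] with t ht
    obtain ⟨s, hs, rfl⟩ := hivt 0 t ht
    exact ⟨_, Real.exp_pos s, (hfφ s).symm⟩

/-- If a half-line that ends in a point outside of an open arc lies in this arc, then it contains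
one of the ends of the arc, and this end converges to the point. -/
theorem exists_end_tendsto {X : Type*} [TopologicalSpace X] [T2Space X] {f c : ℝ → X}
    (hf : IsOpenEmbedding f) (hc : IsOpenEmbedding c) (h0 : c 0 ∉ range f)
    (hsub : c '' Ioi 0 ⊆ range f) :
    (Tendsto f atBot (𝓝 (c 0)) ∧ ∀ᶠ t in atBot, f t ∈ c '' Ioi 0) ∨
      (Tendsto f atTop (𝓝 (c 0)) ∧ ∀ᶠ t in atTop, f t ∈ c '' Ioi 0) := by
  have hex : ∀ s, ∃ t, f t = c (Real.exp s) := fun s => hsub ⟨_, Real.exp_pos s, rfl⟩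
  choose φ hφ using hex
  have hφc : Continuous φ := by
    rw [hf.isInducing.continuous_iff]
    exact (hc.continuous.comp Real.continuous_exp).congr fun s => (hφ s).symm
  have hφi : Function.Injective φ := fun s t hst =>
    Real.exp_injective (hc.injective (by rw [← hφ, ← hφ, hst]))
  rcases hφc.strictMono_of_inj hφi with hm | hm
  · exact Or.inl (tendsto_atBot_of_strictMono hf.continuous hc.continuous h0 hφc hφ hm)
  · have h := tendsto_atBot_of_strictMono (f := fun t => f (-t)) (φ := fun s => -φ s)
      (hf.continuous.comp continuous_neg) hc.continuous
      (by rintro ⟨t, ht⟩; exact h0 ⟨-t, ht⟩) hφc.neg (fun s => by rw [neg_neg, hφ])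
      (fun s t hst => neg_lt_neg (hm hst))
    refine Or.inr ⟨?_, ?_⟩
    · simpa [Function.comp_def] using h.1.comp tendsto_neg_atTop_atBot
    · simpa using tendsto_neg_atTop_atBot.eventually h.2

/-- Two disjoint open arcs with a common end point are glued to an open arc. -/
theorem exists_isOpenEmbedding_glue {X : Type*} [TopologicalSpace X] {f₁ f₂ c : ℝ → X} {p : X}
    (hf₁ : IsOpenEmbedding f₁) (hf₂ : IsOpenEmbedding f₂) (hc : IsOpenEmbedding c)
    (hp : p ∈ range c) (hp₁ : p ∉ range f₁) (hp₂ : p ∉ range f₂)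
    (hdisj : Disjoint (range f₁) (range f₂)) (h₁ : Tendsto f₁ atTop (𝓝 p))
    (h₂ : Tendsto f₂ atBot (𝓝 p)) :
    ∃ g : ℝ → X, IsOpenEmbedding g ∧ range g = insert p (range f₁ ∪ range f₂) := by
  -- Since `Real.log t = log |t|`, the argument of `f₁` tends to `+∞` as `t` increases to `0`, and
  -- that of `f₂` tends to `-∞` as `t` decreases to `0`.
  set g : ℝ → X := fun t =>
    if t < 0 then f₁ (-Real.log t) else if t = 0 then p else f₂ (Real.log t) with hg
  have gneg : ∀ t < 0, g t = f₁ (-Real.log t) := fun t ht => by simp [hg, ht]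
  have gzero : g 0 = p := by simp [hg]
  have gpos : ∀ t > 0, g t = f₂ (Real.log t) := fun t ht => by simp [hg, ht.le.not_gt, ht.ne']
  have hcont : Continuous g := by
    rw [continuous_iff_continuousAt]
    intro t
    rcases lt_trichotomy t 0 with ht | rfl | ht
    · refine ContinuousAt.congr (f := fun t => f₁ (-Real.log t)) ?_ ?_
      · exact hf₁.continuous.continuousAt.comp (Real.continuousAt_log ht.ne).neg
      · filter_upwards [Iio_mem_nhds ht] with s hs using (gneg s hs).symm
    · rw [continuousAt_iff_continuous_left'_right']
      constructor
      · have hl : Tendsto (fun t => f₁ (-Real.log t)) (𝓝[<] 0) (𝓝 p) :=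
          h₁.comp (tendsto_neg_atBot_atTop.comp
            (Real.tendsto_log_nhdsNE_zero.mono_left (nhdsWithin_mono _ fun x hx => ne_of_lt hx)))
        rw [ContinuousWithinAt, gzero]
        exact hl.congr' (by filter_upwards [self_mem_nhdsWithin] with s hs using (gneg s hs).symm)
      · have hr : Tendsto (fun t => f₂ (Real.log t)) (𝓝[>] 0) (𝓝 p) :=
          h₂.comp
            (Real.tendsto_log_nhdsNE_zero.mono_left (nhdsWithin_mono _ fun x hx => ne_of_gt hx))
        rw [ContinuousWithinAt, gzero]
        exact hr.congr' (by filter_upwards [self_mem_nhdsWithin] with s hs using (gpos s hs).symm)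
    · refine ContinuousAt.congr (f := fun t => f₂ (Real.log t)) ?_ ?_
      · exact hf₂.continuous.continuousAt.comp (Real.continuousAt_log ht.ne')
      · filter_upwards [Ioi_mem_nhds ht] with s hs using (gpos s hs).symm
  have hinj : Function.Injective g := by
    have h12 : ∀ a b, f₁ a ≠ f₂ b := fun a b hab => disjoint_left.1 hdisj ⟨a, rfl⟩ ⟨b, hab.symm⟩
    have h1p : ∀ a, f₁ a ≠ p := fun a ha => hp₁ ⟨a, ha⟩
    have h2p : ∀ a, f₂ a ≠ p := fun a ha => hp₂ ⟨a, ha⟩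
    intro s t hst
    rcases lt_trichotomy s 0 with hs | rfl | hs <;> rcases lt_trichotomy t 0 with ht | rfl | ht
    · rw [gneg s hs, gneg t ht] at hst
      exact Real.strictAntiOn_log.injOn hs ht (neg_injective (hf₁.injective hst))
    · rw [gneg s hs, gzero] at hst
      exact absurd hst (h1p _)
    · rw [gneg s hs, gpos t ht] at hst
      exact absurd hst (h12 _ _)
    · rw [gneg t ht, gzero] at hst
      exact absurd hst.symm (h1p _)
    · rfl
    · rw [gpos t ht, gzero] at hst
      exact absurd hst.symm (h2p _)
    · rw [gpos s hs, gneg t ht] at hst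
      exact absurd hst.symm (h12 _ _)
    · rw [gpos s hs, gzero] at hst
      exact absurd hst (h2p _)
    · rw [gpos s hs, gpos t ht] at hst
      exact Real.log_injOn_pos hs ht (hf₂.injective hst)
  refine ⟨g, isOpenEmbedding_of_forall_mem_range hcont hinj fun t => ?_, ?_⟩
  · rcases lt_trichotomy t 0 with ht | rfl | ht
    · exact ⟨f₁, hf₁, gneg t ht ▸ ⟨_, rfl⟩⟩
    · exact ⟨c, hc, gzero ▸ hp⟩
    · exact ⟨f₂, hf₂, gpos t ht ▸ ⟨_, rfl⟩⟩
  · apply Subset.antisymm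
    · rintro _ ⟨t, rfl⟩
      rcases lt_trichotomy t 0 with ht | rfl | ht
      · exact Or.inr (Or.inl (gneg t ht ▸ ⟨_, rfl⟩))
      · exact Or.inl gzero
      · exact Or.inr (Or.inr (gpos t ht ▸ ⟨_, rfl⟩))
    · rintro x (rfl | ⟨a, rfl⟩ | ⟨a, rfl⟩)
      · exact ⟨0, gzero⟩
      · refine ⟨-Real.exp (-a), ?_⟩
        rw [gneg _ (neg_lt_zero.2 (Real.exp_pos _)), Real.log_neg_eq_log, Real.log_exp, neg_neg]
      · refine ⟨Real.exp a, ?_⟩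
        rw [gpos _ (Real.exp_pos _), Real.log_exp]

theorem nonempty_homeomorph_real_iff {X : Type*} [TopologicalSpace X] {e : Set X} (he : IsOpen e) :
    Nonempty (e ≃ₜ ℝ) ↔ ∃ f : ℝ → X, IsOpenEmbedding f ∧ range f = e := by
  constructor
  · rintro ⟨h⟩
    refine ⟨Subtype.val ∘ h.symm, he.isOpenEmbedding_subtypeVal.comp h.symm.isOpenEmbedding, ?_⟩
    rw [h.symm.surjective.range_comp, Subtype.range_coe]
  · rintro ⟨f, hf, rfl⟩
    exact ⟨hf.isEmbedding.toHomeomorph.symm⟩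

/-- An open isometric segment is an open arc. -/
theorem IsometryOn.exists_isOpenEmbedding {X : Type*} [MetricSpace X] {γ : ℝ → X} {s t : ℝ}
    (hst : s < t) (hγ : IsometryOn γ (Ioo s t)) (hopen : IsOpen (γ '' Ioo s t)) :
    ∃ f : ℝ → X, IsOpenEmbedding f ∧ range f = γ '' Ioo s t ∧ f 0 = γ ((s + t) / 2) := by
  have hπ := Real.pi_pos
  -- The scale for which `(s + t) / 2 + k * arctan x` runs exactly through the interval from `s` to
  -- `t`.
  set k : ℝ := (t - s) / Real.pi with hk
  have hk0 : 0 < k := div_pos (by linarith) hπ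
  have hkπ : k * Real.pi = t - s := by rw [hk]; field_simp
  set κ : ℝ → ℝ := fun x => (s + t) / 2 + k * Real.arctan x with hκ
  have hκc : Continuous κ := by fun_prop
  have hκi : Function.Injective κ := by
    intro x y hxy
    exact Real.arctan_injective (mul_left_cancel₀ hk0.ne' (add_left_cancel hxy))
  have hκe : IsOpenEmbedding κ := isOpenEmbedding_of_forall_mem_range hκc hκi
    fun x => ⟨id, .id, by simp⟩
  have hκm : ∀ x, κ x ∈ Ioo s t := by
    intro x
    have h1 := mul_lt_mul_of_pos_left (Real.neg_pi_div_two_lt_arctan x) hk0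
    have h2 := mul_lt_mul_of_pos_left (Real.arctan_lt_pi_div_two x) hk0
    constructor <;> simp only [hκ] <;> linarith
  have hκs : ∀ y ∈ Ioo s t, ∃ x, κ x = y := by
    intro y hy
    have : (y - (s + t) / 2) / k ∈ Ioo (-(Real.pi / 2)) (Real.pi / 2) := by
      constructor
      · rw [lt_div_iff₀ hk0]; linarith [hy.1]
      · rw [div_lt_iff₀ hk0]; linarith [hy.2]
    refine ⟨Real.tan ((y - (s + t) / 2) / k), ?_⟩
    simp only [hκ]
    rw [Real.arctan_tan this.1 this.2]
    field_simp
    ring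
  have hrange : range (γ ∘ κ) = γ '' Ioo s t := by
    rw [range_comp]
    congr 1
    exact Subset.antisymm (by rintro _ ⟨x, rfl⟩; exact hκm x) hκs
  refine ⟨γ ∘ κ, ⟨?_, hrange ▸ hopen⟩, hrange, by simp [hκ]⟩
  exact hγ.isometry_restrict.isEmbedding.comp (hκe.isEmbedding.codRestrict (Ioo s t) hκm)

theorem IsSegment.nonempty_homeomorph {X : Type*} [MetricSpace X] {V e : Set X} {γ : ℝ → X}
    {s t : ℝ} (h : IsSegment V e γ s t) : Nonempty (e ≃ₜ ℝ) := by
  obtain ⟨f, hf, hr, -⟩ := (h.isometryOn.mono Ioo_subset_Icc_self).exists_isOpenEmbedding h.lt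
    (h.eq ▸ h.isOpen)
  exact (nonempty_homeomorph_real_iff h.isOpen).2 ⟨f, hf, hr.trans h.eq.symm⟩

/-- A point of valence `2` has a chart that avoids a given finite set of other points. -/
theorem HasValence.exists_isOpenEmbedding {X : Type*} [MetricSpace X] {p : X} (h : HasValence p 2)
    {V : Set X} (hV : V.Finite) :
    ∃ c : ℝ → X, IsOpenEmbedding c ∧ c 0 = p ∧ range c ∩ V ⊆ {p} := by
  obtain ⟨c, ε, hc⟩ := hasValence_two_iff.1 h
  have hclosed : IsClosed (V \ {p}) := (hV.subset sdiff_subset).isClosed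
  obtain ⟨δ, hδ, hδV⟩ := Metric.mem_nhds_iff.1
    (hclosed.isOpen_compl.mem_nhds (show p ∈ (V \ {p})ᶜ from fun hp => hp.2 rfl))
  have hη : 0 < min δ ε := lt_min hδ hc.pos
  have hc' := hc.shrink hη (min_le_right _ _)
  set η := min δ ε with hη'
  have himage : c '' Ioo (-η) η = Metric.ball p η := by
    have hd : ∀ t ∈ Icc (-η) η, dist (c t) p = |t| := fun t ht => by
      rw [← hc'.zero, hc'.isometryOn t ht 0 ⟨by linarith, hη.le⟩, sub_zero]
    apply Subset.antisymm
    · rintro _ ⟨t, ht, rfl⟩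
      rw [Metric.mem_ball, hd t (Ioo_subset_Icc_self ht)]
      exact abs_lt.2 ht
    · intro x hx
      obtain ⟨t, ht, rfl⟩ := hc'.cover x (le_of_lt hx)
      rw [Metric.mem_ball, hd t ht] at hx
      exact ⟨t, abs_lt.1 hx, rfl⟩
  obtain ⟨f, hf, hr, h0⟩ := (hc'.isometryOn.mono Ioo_subset_Icc_self).exists_isOpenEmbedding
    (by linarith) (himage ▸ Metric.isOpen_ball)
  refine ⟨f, hf, by rw [h0]; simpa using hc'.zero, ?_⟩
  rw [hr, himage]
  rintro x ⟨hx, hxV⟩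
  by_contra hxp
  exact hδV (Metric.ball_subset_ball (min_le_left _ _) hx) ⟨hxV, hxp⟩

/-! ### Independence of the genus from the subdivision -/

/-- `F` is the family of the components of the complement of `V`, each of which is an open arc or
compact. -/
structure IsPartition {X : Type*} [TopologicalSpace X] (V : Set X) (F : Set (Set X)) : Prop where
  finite : F.Finite
  isOpen : ∀ e ∈ F, IsOpen e
  isPreconnected : ∀ e ∈ F, IsPreconnected e
  nonempty : ∀ e ∈ F, e.Nonempty
  eq_of_inter : ∀ e ∈ F, ∀ e' ∈ F, (e ∩ e').Nonempty → e = e'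
  sUnion : ⋃₀ F = Vᶜ
  arc_or_compact : ∀ e ∈ F, Nonempty (e ≃ₜ ℝ) ∨ IsCompact e

/-- The members of a family of sets that are homeomorphic to an open interval. -/
def arcsOf {X : Type*} [TopologicalSpace X] (F : Set (Set X)) : Set (Set X) :=
  {e ∈ F | Nonempty (e ≃ₜ ℝ)}

section Partition

variable {X : Type*} [TopologicalSpace X] {V : Set X} {F : Set (Set X)}

theorem IsPartition.exists_superset (h : IsPartition V F) {S : Set X} (hS : IsPreconnected S)
    (hne : S.Nonempty) (hSV : S ⊆ Vᶜ) : ∃ e ∈ F, S ⊆ e := by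
  obtain ⟨x, hx⟩ := hne
  have hxF := hSV hx
  rw [← h.sUnion] at hxF
  obtain ⟨e, he, hxe⟩ := hxF
  refine ⟨e, he, hS.subset_left_of_subset_union (h.isOpen e he)
    (isOpen_sUnion fun e' he' => h.isOpen e' he'.1 : IsOpen (⋃₀ (F \ {e}))) ?_ ?_ ⟨x, hx, hxe⟩⟩
  · rw [disjoint_left]
    rintro y hy ⟨e', he', hye'⟩
    exact he'.2 (h.eq_of_inter e' he'.1 e he ⟨y, hye', hy⟩)
  · rw [← h.sUnion] at hSV
    intro y hy
    obtain ⟨e', he', hye'⟩ := hSV hy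
    by_cases hee : e' = e
    · exact Or.inl (hee ▸ hye')
    · exact Or.inr ⟨e', ⟨he', hee⟩, hye'⟩

theorem IsPartition.setOf_connectedComponentIn (h : IsPartition V F) :
    {e | ∃ x ∈ Vᶜ, e = connectedComponentIn Vᶜ x} = F := by
  have key : ∀ e ∈ F, ∀ x ∈ e, connectedComponentIn Vᶜ x = e := by
    intro e he x hx
    have heV : e ⊆ Vᶜ := h.sUnion ▸ subset_sUnion_of_mem he
    refine Subset.antisymm ?_ ((h.isPreconnected e he).subset_connectedComponentIn hx heV)
    obtain ⟨e', he', hsub⟩ := h.exists_superset isPreconnected_connectedComponentIn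
      ⟨x, mem_connectedComponentIn (heV hx)⟩ (connectedComponentIn_subset Vᶜ x)
    rwa [h.eq_of_inter e he e' he' ⟨x, hx, hsub (mem_connectedComponentIn (heV hx))⟩]
  ext e
  constructor
  · rintro ⟨x, hx, rfl⟩
    obtain ⟨e, he, hxe⟩ := h.sUnion.symm ▸ hx
    rwa [key e he x hxe]
  · intro he
    obtain ⟨x, hx⟩ := h.nonempty e he
    exact ⟨x, h.sUnion ▸ ⟨e, he, hx⟩, (key e he x hx).symm⟩

theorem IsPartition.notMem (h : IsPartition V F) {p : X} (hp : p ∈ V) : ∀ e ∈ F, p ∉ e :=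
  fun e he hx => (h.sUnion ▸ subset_sUnion_of_mem he : e ⊆ Vᶜ) hx hp

/-- A half-line that ends in a point of `V` contains an end of some open arc of the partition. -/
theorem IsPartition.exists_end [T2Space X] (h : IsPartition V F) {c : ℝ → X}
    (hc : IsOpenEmbedding c) (h0 : c 0 ∈ V) (hm : ∀ t, 0 < t → c t ∈ Vᶜ) :
    ∃ K ∈ F, c '' Ioi 0 ⊆ K ∧ ∃ f : ℝ → X, IsOpenEmbedding f ∧ range f = K ∧
      ((Tendsto f atBot (𝓝 (c 0)) ∧ ∀ᶠ t in atBot, f t ∈ c '' Ioi 0) ∨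
        (Tendsto f atTop (𝓝 (c 0)) ∧ ∀ᶠ t in atTop, f t ∈ c '' Ioi 0)) := by
  have hnotin := h.notMem h0
  obtain ⟨K, hK, hsub⟩ := h.exists_superset
    (isPreconnected_Ioi.image c hc.continuous.continuousOn) (nonempty_Ioi.image c)
    (by rintro _ ⟨t, ht, rfl⟩; exact hm t ht)
  -- A compact member is closed and would contain the limit `c 0` of the half-line, which lies in
  -- `V`.
  have harc : Nonempty (K ≃ₜ ℝ) := by
    refine (h.arc_or_compact K hK).resolve_right fun hcomp => hnotin K hK ?_
    rw [← hcomp.isClosed.closure_eq]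
    refine closure_mono hsub ?_
    have : (0 : ℝ) ∈ closure (Ioi 0) := by rw [closure_Ioi]; exact self_mem_Ici
    exact image_closure_subset_closure_image hc.continuous ⟨0, this, rfl⟩
  obtain ⟨f, hf, rfl⟩ := (nonempty_homeomorph_real_iff (h.isOpen K hK)).1 harc
  exact ⟨_, hK, hsub, f, hf, rfl, exists_end_tendsto hf hc (hnotin _ hK) hsub⟩

/-- Two members of the partition are merged at a point of `V`. -/
theorem IsPartition.merge (h : IsPartition V F) {p : X} (hp : p ∈ V) {K₁ K₂ D : Set X}
    (hK₁ : K₁ ∈ F) (hK₂ : K₂ ∈ F) (hD : D = insert p (K₁ ∪ K₂)) (hDopen : IsOpen D)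
    (hDconn : IsPreconnected D) (hDac : Nonempty (D ≃ₜ ℝ) ∨ IsCompact D) :
    IsPartition (V \ {p}) (insert D (F \ {K₁, K₂})) := by
  have hDinter : ∀ e ∈ F \ {K₁, K₂}, ¬ (D ∩ e).Nonempty := by
    rintro e ⟨he, hne⟩ ⟨x, hx, hxe⟩
    rw [hD] at hx
    rcases hx with rfl | hx | hx
    · exact h.notMem hp e he hxe
    · exact hne (Or.inl (h.eq_of_inter e he K₁ hK₁ ⟨x, hxe, hx⟩))
    · exact hne (Or.inr (h.eq_of_inter e he K₂ hK₂ ⟨x, hxe, hx⟩))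
  refine ⟨(h.finite.subset sdiff_subset).insert D, ?_, ?_, ?_, ?_, ?_, ?_⟩
  · rintro e (rfl | he)
    exacts [hDopen, h.isOpen e he.1]
  · rintro e (rfl | he)
    exacts [hDconn, h.isPreconnected e he.1]
  · rintro e (rfl | he)
    exacts [hD ▸ ⟨_, mem_insert _ _⟩, h.nonempty e he.1]
  · rintro e (rfl | he) e' (rfl | he') hee
    · rfl
    · exact absurd hee (hDinter e' he')
    · exact absurd (inter_comm _ _ ▸ hee) (hDinter e he)
    · exact h.eq_of_inter e he.1 e' he'.1 hee
  · have hcompl : (V \ {p})ᶜ = insert p (⋃₀ F) := by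
      rw [h.sUnion, Set.compl_sdiff, singleton_union]
    rw [hcompl, sUnion_insert, hD]
    apply Subset.antisymm
    · rintro x ((rfl | hx | hx) | ⟨e, he, hx⟩)
      exacts [Or.inl rfl, Or.inr ⟨K₁, hK₁, hx⟩, Or.inr ⟨K₂, hK₂, hx⟩, Or.inr ⟨e, he.1, hx⟩]
    · rintro x (rfl | ⟨e, he, hx⟩)
      · exact Or.inl (Or.inl rfl)
      · by_cases h1 : e = K₁
        · exact Or.inl (Or.inr (Or.inl (h1 ▸ hx)))
        · by_cases h2 : e = K₂
          · exact Or.inl (Or.inr (Or.inr (h2 ▸ hx)))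
          · exact Or.inr ⟨e, ⟨he, by rintro (h3 | h3); exacts [h1 h3, h2 h3]⟩, hx⟩
  · rintro e (rfl | he)
    exacts [hDac, h.arc_or_compact e he.1]

end Partition

theorem IsSubdivision.isPartition {X : Type*} [MetricSpace X] {V : Set X} (h : IsSubdivision V) :
    IsPartition V (edgesOf V) := by
  refine ⟨h.finite_edges, ?_, ?_, ?_, fun e he e' he' => eq_of_mem_edgesOf he he', ?_, ?_⟩
  · rintro e ⟨γ, s, t, he⟩; exact he.isOpen
  · rintro e ⟨γ, s, t, he⟩; exact he.isPreconnected
  · rintro e ⟨γ, s, t, he⟩; exact he.nonempty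
  · refine Subset.antisymm ?_ h.cover
    rintro x ⟨e, ⟨γ, s, t, he⟩, hx⟩
    exact disjoint_left.1 he.disjoint hx
  · rintro e ⟨γ, s, t, he⟩; exact Or.inl he.nonempty_homeomorph

/-- Removing a point of valence `2` from `V` lowers the number of open arcs by one: either it joins
two arcs, or it closes an arc to a circle. -/
theorem IsPartition.exists_remove {X : Type*} [MetricSpace X] {V : Set X} {F : Set (Set X)}
    (h : IsPartition V F) (hV : V.Finite) {p : X} (hpV : p ∈ V) (hp : HasValence p 2) :
    ∃ F', IsPartition (V \ {p}) F' ∧ (arcsOf F').ncard + 1 = (arcsOf F).ncard := by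
  obtain ⟨c, hc, rfl, hcV⟩ := hp.exists_isOpenEmbedding hV
  have hcVt : ∀ t, t ≠ 0 → c t ∈ Vᶜ := fun t ht htV =>
    ht (hc.injective (hcV ⟨⟨t, rfl⟩, htV⟩))
  have hnotin := h.notMem hpV
  have hc' : IsOpenEmbedding fun t => c (-t) := hc.comp (Homeomorph.neg ℝ).isOpenEmbedding
  have hneg : (fun t => c (-t)) '' Ioi 0 = c '' Iio 0 := by
    ext x
    constructor
    · rintro ⟨t, ht, rfl⟩
      exact ⟨-t, mem_Iio.2 (neg_lt_zero.2 ht), rfl⟩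
    · rintro ⟨t, ht, rfl⟩
      exact ⟨-t, mem_Ioi.2 (neg_pos.2 ht), by simp⟩
  obtain ⟨K₂, hK₂, hsub₂, f₂, hf₂, hr₂, hend₂⟩ := h.exists_end hc hpV fun t ht => hcVt t ht.ne'
  obtain ⟨K₁, hK₁, hsub₁, f₁, hf₁, hr₁, hend₁⟩ := h.exists_end hc' (by simpa using hpV)
    fun t ht => hcVt (-t) (neg_ne_zero.2 ht.ne')
  simp only [hneg, neg_zero] at hsub₁ hend₁
  set D : Set X := insert (c 0) (K₁ ∪ K₂) with hD
  have hDF : D ∉ F := fun hDF => hnotin D hDF (mem_insert _ _)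
  have hDeq : D = K₁ ∪ range c ∪ K₂ := by
    apply Subset.antisymm
    · rintro x (rfl | hx | hx)
      · exact Or.inl (Or.inr ⟨0, rfl⟩)
      · exact Or.inl (Or.inl hx)
      · exact Or.inr hx
    · rintro x ((hx | ⟨t, rfl⟩) | hx)
      · exact Or.inr (Or.inl hx)
      · rcases lt_trichotomy t 0 with ht | rfl | ht
        · exact Or.inr (Or.inl (hsub₁ ⟨t, ht, rfl⟩))
        · exact Or.inl rfl
        · exact Or.inr (Or.inr (hsub₂ ⟨t, ht, rfl⟩))
      · exact Or.inr (Or.inr hx)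
  have hDopen : IsOpen D :=
    hDeq ▸ ((h.isOpen _ hK₁).union hc.isOpen_range).union (h.isOpen _ hK₂)
  have hDconn : IsPreconnected D := by
    rw [hDeq]
    refine IsPreconnected.union (c 1) (Or.inr ⟨1, rfl⟩) (hsub₂ ⟨1, mem_Ioi.2 one_pos, rfl⟩) ?_
      (h.isPreconnected _ hK₂)
    exact IsPreconnected.union (c (-1)) (hsub₁ ⟨-1, mem_Iio.2 neg_one_lt_zero, rfl⟩) ⟨-1, rfl⟩
      (h.isPreconnected _ hK₁) (isPreconnected_range hc.continuous)
  have hpart := h.merge hpV hK₁ hK₂ hD hDopen hDconn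
  have hfin : (arcsOf F).Finite := h.finite.subset fun e he => he.1
  have harc₁ : K₁ ∈ arcsOf F :=
    ⟨hK₁, (nonempty_homeomorph_real_iff (h.isOpen _ hK₁)).2 ⟨f₁, hf₁, hr₁⟩⟩
  have harc₂ : K₂ ∈ arcsOf F :=
    ⟨hK₂, (nonempty_homeomorph_real_iff (h.isOpen _ hK₂)).2 ⟨f₂, hf₂, hr₂⟩⟩
  by_cases hKK : K₁ = K₂
  · subst hKK
    have hcompact : IsCompact D := by
      -- The two halves of the chart are disjoint, so they cannot contain the same end of the arc.
      have hsep : ∀ l : Filter ℝ, l.NeBot → (∀ᶠ t in l, f₂ t ∈ c '' Ioi 0) →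
          (∀ᶠ t in l, f₂ t ∈ c '' Iio 0) → False := by
        intro l _ h1 h2
        obtain ⟨t, ⟨a, ha, hat⟩, ⟨b, hb, hbt⟩⟩ := (h1.and h2).exists
        have hab := hc.injective (hat.trans hbt.symm)
        rw [mem_Ioi] at ha
        rw [mem_Iio] at hb
        linarith
      -- The ends are compared in one parametrization: `hend₁` refers to `f₁`, which may parametrize
      -- the same arc differently.
      have hend : (Tendsto f₂ atBot (𝓝 (c 0)) ∧ ∀ᶠ t in atBot, f₂ t ∈ c '' Iio 0) ∨
          (Tendsto f₂ atTop (𝓝 (c 0)) ∧ ∀ᶠ t in atTop, f₂ t ∈ c '' Iio 0) := by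
        have := exists_end_tendsto hf₂ hc' (by rw [hr₂]; simpa using hnotin _ hK₂)
          (by rw [hneg, hr₂]; exact hsub₁)
        simpa only [hneg, neg_zero] using this
      -- Both ends of the arc converge to the removed vertex, so adding it gives a compact set. This
      -- circle is not an arc, and the count drops by one.
      have hboth : Tendsto f₂ (cocompact ℝ) (𝓝 (c 0)) := by
        rw [cocompact_eq_atBot_atTop, tendsto_sup]
        rcases hend₂ with h2 | h2 <;> rcases hend with h1 | h1
        · exact (hsep _ inferInstance h2.2 h1.2).elim
        · exact ⟨h2.1, h1.1⟩
        · exact ⟨h1.1, h2.1⟩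
        · exact (hsep _ inferInstance h2.2 h1.2).elim
      have := hboth.isCompact_insert_range_of_cocompact hf₂.continuous
      rwa [hr₂, ← union_self K₁] at this
    refine ⟨_, hpart (Or.inr hcompact), ?_⟩
    have hDarc : ¬ Nonempty (D ≃ₜ ℝ) := by
      rintro ⟨φ⟩
      have := isCompact_iff_compactSpace.1 hcompact
      have := φ.compactSpace
      exact noncompact_univ ℝ isCompact_univ
    have : arcsOf (insert D (F \ {K₁, K₁})) = arcsOf F \ {K₁} := by
      rw [pair_eq_singleton]
      ext e
      constructor
      · rintro ⟨rfl | he, hea⟩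
        exacts [absurd hea hDarc, ⟨⟨he.1, hea⟩, he.2⟩]
      · rintro ⟨⟨he, hea⟩, hne⟩
        exact ⟨Or.inr ⟨he, hne⟩, hea⟩
    rw [this, ncard_sdiff_singleton_add_one harc₁ hfin]
  · have hdisj : Disjoint K₁ K₂ := by
      rw [disjoint_left]
      exact fun x hx₁ hx₂ => hKK (h.eq_of_inter _ hK₁ _ hK₂ ⟨x, hx₁, hx₂⟩)
    have hDarc : Nonempty (D ≃ₜ ℝ) := by
      have hfn : ∀ f : ℝ → X, IsOpenEmbedding f → IsOpenEmbedding (fun t => f (-t)) ∧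
          range (fun t => f (-t)) = range f := fun f hf =>
        ⟨hf.comp (Homeomorph.neg ℝ).isOpenEmbedding, (Equiv.neg ℝ).surjective.range_comp f⟩
      -- Each arc is reversed if necessary, so that the first one ends at the vertex and the second
      -- one begins there.
      obtain ⟨g₁, hg₁, hgr₁, ht₁⟩ : ∃ g : ℝ → X, IsOpenEmbedding g ∧ range g = K₁ ∧
          Tendsto g atTop (𝓝 (c 0)) := by
        rcases hend₁ with h1 | h1
        · exact ⟨_, (hfn f₁ hf₁).1, (hfn f₁ hf₁).2.trans hr₁, h1.1.comp tendsto_neg_atTop_atBot⟩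
        · exact ⟨f₁, hf₁, hr₁, h1.1⟩
      obtain ⟨g₂, hg₂, hgr₂, ht₂⟩ : ∃ g : ℝ → X, IsOpenEmbedding g ∧ range g = K₂ ∧
          Tendsto g atBot (𝓝 (c 0)) := by
        rcases hend₂ with h1 | h1
        · exact ⟨f₂, hf₂, hr₂, h1.1⟩
        · exact ⟨_, (hfn f₂ hf₂).1, (hfn f₂ hf₂).2.trans hr₂, h1.1.comp tendsto_neg_atBot_atTop⟩
      obtain ⟨g, hg, hgr⟩ := exists_isOpenEmbedding_glue hg₁ hg₂ hc ⟨0, rfl⟩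
        (hgr₁ ▸ hnotin _ hK₁) (hgr₂ ▸ hnotin _ hK₂) (by rwa [hgr₁, hgr₂]) ht₁ ht₂
      exact (nonempty_homeomorph_real_iff hDopen).2 ⟨g, hg, by rw [hgr, hgr₁, hgr₂]⟩
    refine ⟨_, hpart (Or.inl hDarc), ?_⟩
    have : arcsOf (insert D (F \ {K₁, K₂})) = insert D ((arcsOf F \ {K₁}) \ {K₂}) := by
      ext e
      constructor
      · rintro ⟨rfl | he, hea⟩
        · exact Or.inl rfl
        · exact Or.inr ⟨⟨⟨he.1, hea⟩, fun h1 => he.2 (Or.inl h1)⟩, fun h1 => he.2 (Or.inr h1)⟩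
      · rintro (rfl | ⟨⟨⟨he, hea⟩, h1⟩, h2⟩)
        · exact ⟨Or.inl rfl, hDarc⟩
        · exact ⟨Or.inr ⟨he, by rintro (h3 | h3); exacts [h1 h3, h2 h3]⟩, hea⟩
    have harc₂' : K₂ ∈ arcsOf F \ {K₁} := ⟨harc₂, Ne.symm hKK⟩
    rw [this, ncard_insert_of_notMem (fun hx => hDF hx.1.1.1) (hfin.sdiff.sdiff),
      ncard_sdiff_singleton_add_one harc₂' hfin.sdiff,
      ncard_sdiff_singleton_add_one harc₁ hfin]

/-- Each removal lowers the number of vertices and the number of arcs by one, so their difference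
survives down to the true vertex set. The number `n` of superfluous vertices is the induction
variable. -/
theorem IsPartition.exists_remove_all {X : Type*} [MetricSpace X] (n : ℕ) :
    ∀ {V : Set X} {F : Set (Set X)}, IsPartition V F → V.Finite → vertexSet X ⊆ V →
      (V \ vertexSet X).ncard = n →
      ∃ F', IsPartition (vertexSet X) F' ∧ (arcsOf F').ncard + n = (arcsOf F).ncard := by
  induction n with
  | zero =>
    intro V F h hV hsub hn
    rw [ncard_eq_zero hV.sdiff, sdiff_eq_empty] at hn
    obtain rfl := hsub.antisymm hn
    exact ⟨F, h, rfl⟩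
  | succ n ih =>
    intro V F h hV hsub hn
    obtain ⟨p, hpV, hp⟩ : (V \ vertexSet X).Nonempty := by
      rw [← ncard_pos hV.sdiff]; omega
    obtain ⟨F₁, hF₁, hcard₁⟩ := h.exists_remove hV hpV (not_not.1 hp)
    have heq : (V \ {p}) \ vertexSet X = (V \ vertexSet X) \ {p} := by
      rw [sdiff_sdiff_comm]
    obtain ⟨F', hF', hcard⟩ := ih hF₁ hV.sdiff
      (fun x hx => ⟨hsub hx, fun hxp => hp (mem_singleton_iff.1 hxp ▸ hx)⟩) (by
        have hp' : p ∈ V \ vertexSet X := ⟨hpV, hp⟩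
        have := ncard_sdiff_singleton_add_one hp' hV.sdiff
        rw [heq]; omega)
    exact ⟨F', hF', by omega⟩

/-- Finiteness and the genus of a graph can be read off from any subdivision. -/
theorem IsSubdivision.isFiniteGraph_and_genus_eq {X : Type*} [MetricSpace X] {V : Set X}
    (h : IsSubdivision V) : IsFiniteGraph X ∧
      genus X = (Nat.card (ConnectedComponents X) : ℤ) + ((edgesOf V).ncard : ℤ) - V.ncard := by
  obtain ⟨F, hF, hcard⟩ := h.isPartition.exists_remove_all _ h.finite h.vertexSet_subset rfl
  have hedge : edgeSet X = arcsOf F := by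
    rw [← hF.setOf_connectedComponentIn]
    rfl
  have harcs : arcsOf (edgesOf V) = edgesOf V :=
    Subset.antisymm (sep_subset _ _)
      (by rintro e ⟨γ, s, t, he⟩; exact ⟨⟨γ, s, t, he⟩, he.nonempty_homeomorph⟩)
  refine ⟨⟨h.finite.subset h.vertexSet_subset, ?_⟩, ?_⟩
  · rw [hedge]
    exact hF.finite.subset fun e he => he.1
  rw [harcs] at hcard
  have hV := ncard_sdiff_add_ncard_of_subset h.vertexSet_subset h.finite
  rw [genus, hedge]
  omega

end Ends

/-! ### Subdivision of the components of the real locus -/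

/-- An isometrically embedded subspace that contains, with any point of a segment, the whole closed
segment inherits the subdivision. -/
theorem IsSubdivision.comap {X Y : Type*} [MetricSpace X] [MetricSpace Y] {V : Set X}
    (h : IsSubdivision V) {j : Y → X} (hj : Isometry j)
    (hclosed : ∀ e ∈ edgesOf V, (e ∩ range j).Nonempty → closure e ⊆ range j) :
    IsSubdivision (j ⁻¹' V) ∧ (j ⁻¹' V).ncard = (V ∩ range j).ncard ∧
      (edgesOf (j ⁻¹' V)).ncard = {e ∈ edgesOf V | e ⊆ range j}.ncard := by
  have hseg : ∀ e ∈ edgesOf V, (e ∩ range j).Nonempty → j ⁻¹' e ∈ edgesOf (j ⁻¹' V) := by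
    rintro e ⟨γ, s, t, he⟩ hne
    have hcl := hclosed e ⟨γ, s, t, he⟩ hne
    rw [he.closure_eq, ← he.image_Icc] at hcl
    obtain ⟨_, -, y₀, rfl⟩ := hne
    have : Nonempty Y := ⟨y₀⟩
    have hinv : ∀ x ∈ Icc s t, j (Function.invFun j (γ x)) = γ x := fun x hx =>
      Function.invFun_eq (hcl ⟨x, hx, rfl⟩)
    have hs : s ∈ Icc s t := left_mem_Icc.2 he.lt.le
    have ht : t ∈ Icc s t := right_mem_Icc.2 he.lt.le
    refine ⟨fun x => Function.invFun j (γ x), s, t, he.lt, ?_, ?_, ?_, ?_,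
      he.isOpen.preimage hj.continuous, he.disjoint.preimage j⟩
    · intro x hx y hy
      rw [← hj.dist_eq, hinv x hx, hinv y hy, he.isometryOn x hx y hy]
    · rw [mem_preimage, hinv s hs]; exact he.left_mem
    · rw [mem_preimage, hinv t ht]; exact he.right_mem
    · apply hj.injective.image_injective
      rw [image_preimage_eq_of_subset (fun x hx => hcl ?_), he.eq, image_image]
      · exact image_congr fun x hx => (hinv x (Ioo_subset_Icc_self hx)).symm
      · rw [he.eq] at hx
        exact image_mono Ioo_subset_Icc_self hx
  have hcov : (j ⁻¹' V)ᶜ ⊆ ⋃₀ edgesOf (j ⁻¹' V) := by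
    intro y hy
    obtain ⟨e, he, hye⟩ := h.cover hy
    exact ⟨_, hseg e he ⟨j y, hye, y, rfl⟩, hye⟩
  have heq : edgesOf (j ⁻¹' V) = preimage j '' {e ∈ edgesOf V | e ⊆ range j} := by
    apply Subset.antisymm
    · rintro e' ⟨γ, s, t, he'⟩
      obtain ⟨y, hy⟩ := he'.nonempty
      obtain ⟨e, he, hye⟩ := h.cover (show j y ∈ Vᶜ from disjoint_left.1 he'.disjoint hy)
      have hne : (e ∩ range j).Nonempty := ⟨j y, hye, y, rfl⟩
      exact ⟨e, ⟨he, subset_closure.trans (hclosed e he hne)⟩,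
        eq_of_mem_edgesOf (hseg e he hne) ⟨γ, s, t, he'⟩ ⟨y, hye, hy⟩⟩
    · rintro _ ⟨e, ⟨he, hsub⟩, rfl⟩
      obtain ⟨γ, s, t, hs⟩ := id he
      obtain ⟨x, hx⟩ := hs.nonempty
      exact hseg e he ⟨x, hx, hsub hx⟩
  refine ⟨⟨h.finite.preimage hj.injective.injOn, ?_, hcov⟩, ?_, ?_⟩
  · rw [heq]
    exact (h.finite_edges.subset (sep_subset _ _)).image _
  · rw [← image_preimage_eq_inter_range, ncard_image_of_injective _ hj.injective]
  · rw [heq, InjOn.ncard_image]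
    intro e he e' he' hee
    rw [← image_preimage_eq_of_subset he.2, ← image_preimage_eq_of_subset he'.2]
    exact congrArg _ hee

theorem nat_card_connectedComponents {X : Type*} [TopologicalSpace X] [ConnectedSpace X] :
    Nat.card (ConnectedComponents X) = 1 := by
  rw [Nat.card_eq_one_iff_unique]
  exact ⟨inferInstance, inferInstance⟩

section RealLocus

variable {Γ : Type*} [MetricSpace Γ] {ι : Γ → Γ}

instance connectedSpace_realComponent (C : ConnectedComponents (realLocus ι)) :
    ConnectedSpace (realComponent ι C) := by
  obtain ⟨x, rfl⟩ := ConnectedComponents.surjective_coe C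
  refine Subtype.connectedSpace ?_
  have : realComponent ι (x : ConnectedComponents (realLocus ι)) = connectedComponent x := by
    ext y
    exact ConnectedComponents.coe_eq_coe'
  rw [this]
  exact isConnected_connectedComponent

/-- The inclusion of a component of the real locus. -/
def realComponentIncl (C : ConnectedComponents (realLocus ι)) (x : realComponent ι C) : Γ :=
  x.1.1

theorem isometry_realComponentIncl (C : ConnectedComponents (realLocus ι)) :
    Isometry (realComponentIncl C) :=
  isometry_subtype_coe.comp isometry_subtype_coe

theorem mem_range_realComponentIncl {C : ConnectedComponents (realLocus ι)} {x : Γ} :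
    x ∈ range (realComponentIncl C) ↔
      ∃ h : x ∈ realLocus ι, ConnectedComponents.mk (⟨x, h⟩ : realLocus ι) = C := by
  constructor
  · rintro ⟨y, rfl⟩
    exact ⟨y.1.2, y.2⟩
  · rintro ⟨h, hC⟩
    exact ⟨⟨⟨x, h⟩, hC⟩, rfl⟩

theorem mk_eq_mk_of_isPreconnected {S : Set Γ} (hS : IsPreconnected S) (hSR : S ⊆ realLocus ι)
    {x y : Γ} (hx : x ∈ S) (hy : y ∈ S) :
    ConnectedComponents.mk (⟨x, hSR hx⟩ : realLocus ι) = ConnectedComponents.mk ⟨y, hSR hy⟩ := by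
  have : IsPreconnected ((↑) ⁻¹' S : Set (realLocus ι)) := by
    rw [← IsInducing.subtypeVal.isPreconnected_image, Subtype.image_preimage_coe,
      inter_eq_right.2 hSR]
    exact hS
  exact ConnectedComponents.coe_eq_coe'.2
    (this.subset_connectedComponent (x := ⟨y, hSR hy⟩) hy (show (⟨x, hSR hx⟩ : realLocus ι) ∈ _ from hx))

theorem subset_range_realComponentIncl {S : Set Γ} (hS : IsPreconnected S)
    (hSR : S ⊆ realLocus ι) {C : ConnectedComponents (realLocus ι)}
    (hne : (S ∩ range (realComponentIncl C)).Nonempty) : S ⊆ range (realComponentIncl C) := by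
  obtain ⟨x, hx, hxC⟩ := hne
  obtain ⟨h, hC⟩ := mem_range_realComponentIncl.1 hxC
  intro y hy
  exact mem_range_realComponentIncl.2
    ⟨hSR hy, (mk_eq_mk_of_isPreconnected hS hSR hy hx).trans hC⟩

end RealLocus

theorem sum_ncard_sep {α I : Type*} [Fintype I] {S : Set α} (hS : S.Finite) (P : I → α → Prop)
    (hP : ∀ s ∈ S, ∀ i i', P i s → P i' s → i = i') :
    ∑ i, {s ∈ S | P i s}.ncard = {s ∈ S | ∃ i, P i s}.ncard := by
  classical
  lift S to Finset α using hS
  have h1 : ∀ i, {s ∈ (S : Set α) | P i s}.ncard = (S.filter (P i)).card := fun i => by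
    rw [← ncard_coe_finset]; congr 1; ext; simp
  have h2 : {s ∈ (S : Set α) | ∃ i, P i s} =
      ((Finset.univ.biUnion fun i => S.filter (P i) : Finset α) : Set α) := by
    ext; simp
  rw [h2, ncard_coe_finset, Finset.card_biUnion]
  · exact Finset.sum_congr rfl fun i _ => h1 i
  · intro i _ i' _ hii
    rw [Function.onFun, Finset.disjoint_left]
    intro s hs hs'
    rw [Finset.mem_filter] at hs hs'
    exact hii (hP s hs.1 i i' hs.2 hs'.2)

section Fine

variable {Γ : Type*} [MetricSpace Γ] {ι : Γ → Γ} {V : Set Γ}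

/-- If all boundary points of the real locus are vertices, then every edge lies in the real locus or
outside it. -/
theorem subset_or_disjoint_realLocus (hf : frontier (realLocus ι) ⊆ V)
    {e : Set Γ} (he : e ∈ edgesOf V) : e ⊆ realLocus ι ∨ Disjoint e (realLocus ι) := by
  obtain ⟨γ, s, t, hs⟩ := he
  have hsub : e ⊆ interior (realLocus ι) ∪ (closure (realLocus ι))ᶜ := by
    intro x hx
    by_contra hn
    simp only [mem_union, mem_compl_iff, not_or, not_not] at hn
    exact disjoint_left.1 hs.disjoint hx (hf ⟨hn.2, hn.1⟩)
  have hdisj : Disjoint (interior (realLocus ι)) (closure (realLocus ι))ᶜ :=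
    disjoint_compl_right.mono_left (interior_subset.trans subset_closure)
  rcases hs.isPreconnected.subset_or_subset isOpen_interior isClosed_closure.isOpen_compl hdisj hsub
    with h | h
  · exact Or.inl (h.trans interior_subset)
  · exact Or.inr (disjoint_left.2 fun x hx hxR => h hx (subset_closure hxR))

/-- An edge that meets `C` is real. Its closure is connected, and real because the real locus is
closed, so it stays in the same component. This is the condition needed in `IsSubdivision.comap`. -/
theorem closure_subset_range_realComponentIncl (hι : IsRealStructure ι)
    (hf : frontier (realLocus ι) ⊆ V) (C : ConnectedComponents (realLocus ι)) {e : Set Γ}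
    (he : e ∈ edgesOf V) (hne : (e ∩ range (realComponentIncl C)).Nonempty) :
    closure e ⊆ range (realComponentIncl C) := by
  have heR : e ⊆ realLocus ι := by
    refine (subset_or_disjoint_realLocus hf he).resolve_right fun hd => ?_
    obtain ⟨x, hx, hxC⟩ := hne
    exact disjoint_left.1 hd hx (mem_range_realComponentIncl.1 hxC).1
  obtain ⟨γ, s, t, hs⟩ := he
  exact subset_range_realComponentIncl hs.isPreconnected.closure
    (closure_minimal heR hι.isClosed_realLocus) (hne.mono (inter_subset_inter_left _ subset_closure))

/-- Every component of the real locus contains a vertex. -/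
theorem exists_vertex_mem_realComponent (hι : IsRealStructure ι) (hV : IsSubdivision V)
    (hf : frontier (realLocus ι) ⊆ V) (C : ConnectedComponents (realLocus ι)) :
    ∃ v ∈ V, v ∈ range (realComponentIncl C) := by
  obtain ⟨x, rfl⟩ := ConnectedComponents.surjective_coe C
  have hx : x.1 ∈ range (realComponentIncl (x : ConnectedComponents (realLocus ι))) :=
    mem_range_realComponentIncl.2 ⟨x.2, rfl⟩
  by_cases hxV : x.1 ∈ V
  · exact ⟨x, hxV, hx⟩
  · obtain ⟨e, he, hxe⟩ := hV.cover hxV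
    have hcl := closure_subset_range_realComponentIncl hι hf _ he ⟨x, hxe, hx⟩
    obtain ⟨γ, s, t, hs⟩ := he
    exact ⟨γ s, hs.left_mem, hcl (hs.closure_eq ▸ Or.inr (Or.inl rfl))⟩

theorem finite_connectedComponents_realLocus (hι : IsRealStructure ι) (hV : IsSubdivision V)
    (hf : frontier (realLocus ι) ⊆ V) : Finite (ConnectedComponents (realLocus ι)) := by
  choose v hvV hvC using exists_vertex_mem_realComponent hι hV hf
  have := hV.finite.to_subtype
  refine Finite.of_injective (fun C => (⟨v C, hvV C⟩ : V)) fun C C' h => ?_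
  obtain ⟨h1, h2⟩ := mem_range_realComponentIncl.1 (hvC C)
  obtain ⟨h3, h4⟩ := mem_range_realComponentIncl.1 (hvC C')
  rw [← h2, ← h4]
  congr 2
  exact congrArg Subtype.val h

theorem isFiniteGraph_and_genus_realComponent (hι : IsRealStructure ι) (hV : IsSubdivision V)
    (hf : frontier (realLocus ι) ⊆ V) (C : ConnectedComponents (realLocus ι)) :
    IsFiniteGraph (realComponent ι C) ∧ genus (realComponent ι C) =
      1 + ({e ∈ edgesOf V | e ⊆ range (realComponentIncl C)}.ncard : ℤ) -
        {v ∈ V | v ∈ range (realComponentIncl C)}.ncard := by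
  obtain ⟨h, hv, he⟩ := hV.comap (isometry_realComponentIncl C)
    (fun e => closure_subset_range_realComponentIncl hι hf C)
  obtain ⟨h1, h2⟩ := h.isFiniteGraph_and_genus_eq
  refine ⟨h1, ?_⟩
  rw [h2, nat_card_connectedComponents, hv, he]
  rfl

/-- The invariant `s` in terms of a subdivision. -/
theorem sInvariant_eq (hι : IsRealStructure ι) (hV : IsSubdivision V)
    (hf : frontier (realLocus ι) ⊆ V) :
    sInvariant ι = 2 * (Nat.card (ConnectedComponents (realLocus ι)) : ℤ) +
      ({e ∈ edgesOf V | e ⊆ realLocus ι}.ncard : ℤ) - (V ∩ realLocus ι).ncard := by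
  have := finite_connectedComponents_realLocus hι hV hf
  have := Fintype.ofFinite (ConnectedComponents (realLocus ι))
  have huniq : ∀ (x : Γ) (C C' : ConnectedComponents (realLocus ι)),
      x ∈ range (realComponentIncl C) → x ∈ range (realComponentIncl C') → C = C' := by
    intro x C C' h h'
    obtain ⟨h1, h2⟩ := mem_range_realComponentIncl.1 h
    obtain ⟨h3, h4⟩ := mem_range_realComponentIncl.1 h'
    exact h2.symm.trans h4
  have hvs := sum_ncard_sep hV.finite
    (fun (C : ConnectedComponents (realLocus ι)) v => v ∈ range (realComponentIncl C))
    (fun v _ C C' => huniq v C C')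
  have hes := sum_ncard_sep hV.finite_edges
    (fun (C : ConnectedComponents (realLocus ι)) e => e ⊆ range (realComponentIncl C)) (by
      rintro e ⟨γ, s, t, hs⟩ C C' h h'
      obtain ⟨x, hx⟩ := hs.nonempty
      exact huniq x C C' (h hx) (h' hx))
  have hv' : {v ∈ V | ∃ C : ConnectedComponents (realLocus ι), v ∈ range (realComponentIncl C)} =
      V ∩ realLocus ι := by
    ext v
    constructor
    · rintro ⟨hv, C, hC⟩
      exact ⟨hv, (mem_range_realComponentIncl.1 hC).1⟩
    · rintro ⟨hv, hR⟩
      exact ⟨hv, _, mem_range_realComponentIncl.2 ⟨hR, rfl⟩⟩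
  have he' : {e ∈ edgesOf V | ∃ C : ConnectedComponents (realLocus ι),
      e ⊆ range (realComponentIncl C)} = {e ∈ edgesOf V | e ⊆ realLocus ι} := by
    ext e
    constructor
    · rintro ⟨he, C, hC⟩
      exact ⟨he, fun x hx => (mem_range_realComponentIncl.1 (hC hx)).1⟩
    · rintro ⟨he, hR⟩
      refine ⟨he, ?_⟩
      obtain ⟨γ, s, t, hs⟩ := he
      obtain ⟨x, hx⟩ := hs.nonempty
      exact ⟨_, subset_range_realComponentIncl hs.isPreconnected hR
        ⟨x, hx, mem_range_realComponentIncl.2 ⟨hR hx, rfl⟩⟩⟩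
  rw [← hv', ← he', ← hvs, ← hes, sInvariant, finsum_eq_sum_of_fintype, Nat.card_eq_fintype_card]
  simp only [(isFiniteGraph_and_genus_realComponent hι hV hf _).2]
  push_cast
  simp only [Finset.sum_add_distrib, Finset.sum_sub_distrib, Finset.sum_const, Finset.card_univ,
    nsmul_eq_mul]
  ring

end Fine

/-! ### Cochains modulo 2, free orbits and connectedness -/

/-- The coboundary map modulo 2 of a connected graph with node set `S` and edge set `B`. -/
theorem card_nodes_le {S B : Type*} [Finite S] [Finite B] (u v : B → S)
    (hconn : ∀ ψ : S → ZMod 2, (∀ b, ψ (u b) = ψ (v b)) → ∀ x y, ψ x = ψ y) :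
    Nat.card S ≤ Nat.card B + 1 ∧ (Nat.card B < Nat.card S →
      ∀ ω : B → ZMod 2, ∃ ψ : S → ZMod 2, ∀ b, ψ (u b) + ψ (v b) = ω b) := by
  have := Fintype.ofFinite S
  have := Fintype.ofFinite B
  let δ : (S → ZMod 2) →ₗ[ZMod 2] (B → ZMod 2) :=
    { toFun := fun ψ b => ψ (u b) + ψ (v b)
      map_add' := fun ψ ψ' => by ext b; simp only [Pi.add_apply]; ring
      map_smul' := fun a ψ => by ext b; simp [mul_add] }
  -- By connectedness a cocycle is constant, hence a multiple of any nonzero one.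
  have hker : Module.finrank (ZMod 2) (LinearMap.ker δ) ≤ 1 := by
    refine finrank_le_one_iff.2 ?_
    by_cases hex : ∃ ψ ∈ LinearMap.ker δ, ψ ≠ 0
    · obtain ⟨ψ, hψ, hne⟩ := hex
      have hconst : ∀ φ ∈ LinearMap.ker δ, ∀ x y, φ x = φ y := fun φ hφ =>
        hconn φ fun b => CharTwo.add_eq_zero.1 (congrFun (LinearMap.mem_ker.1 hφ) b)
      obtain ⟨x₀, hx₀⟩ := Function.ne_iff.1 hne
      refine ⟨⟨ψ, hψ⟩, fun φ => ⟨φ.1 x₀ * (ψ x₀)⁻¹, ?_⟩⟩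
      ext x
      change φ.1 x₀ * (ψ x₀)⁻¹ * ψ x = φ.1 x
      rw [hconst ψ hψ x x₀, hconst φ.1 φ.2 x x₀, mul_assoc, inv_mul_cancel₀ hx₀, mul_one]
    · push Not at hex
      exact ⟨0, fun φ => ⟨0, by rw [zero_smul]; exact Subtype.ext (hex φ.1 φ.2).symm⟩⟩
  have hrank := LinearMap.finrank_range_add_finrank_ker δ
  have hrange := Submodule.finrank_le (LinearMap.range δ)
  rw [Module.finrank_fintype_fun_eq_card] at hrank hrange
  rw [Nat.card_eq_fintype_card, Nat.card_eq_fintype_card]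
  refine ⟨by omega, fun hlt ω => ?_⟩
  -- The rank is at least `card S - 1`, and this is at least `card B` by `hlt`.
  have htop : LinearMap.range δ = ⊤ := Submodule.eq_top_of_finrank_eq (by
    rw [Module.finrank_fintype_fun_eq_card]; omega)
  obtain ⟨ψ, hψ⟩ := LinearMap.range_eq_top.1 htop ω
  exact ⟨ψ, fun b => congrFun hψ b⟩

/-- An involution has a set that contains exactly one point of each free orbit. -/
theorem exists_half {α : Type*} {f : α → α} (hf : Function.Involutive f) :
    ∃ H : Set α, ∀ x, f x ≠ x → (f x ∈ H ↔ x ∉ H) := by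
  -- Of each pair, the point that is smaller in a well-order.
  refine ⟨{x | WellOrderingRel x (f x)}, fun x hx => ?_⟩
  simp only [mem_ofPred_eq, hf x]
  constructor
  · exact fun h h' => asymm h h'
  · intro h
    rcases trichotomous_of WellOrderingRel x (f x) with h1 | h1 | h1
    exacts [absurd h1 h, absurd h1.symm hx, h1]

/-- The involution exchanges `S ∩ H` with `S \ H`. -/
theorem ncard_eq_two_mul_half {α : Type*} {f : α → α} (hf : Function.Involutive f) {H S : Set α}
    (hH : ∀ x, f x ≠ x → (f x ∈ H ↔ x ∉ H)) (hS : S.Finite) (hfS : ∀ x ∈ S, f x ∈ S)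
    (hne : ∀ x ∈ S, f x ≠ x) : S.ncard = 2 * (S ∩ H).ncard := by
  have himage : S \ H = f '' (S ∩ H) := by
    ext x
    constructor
    · rintro ⟨hxS, hxH⟩
      exact ⟨f x, ⟨hfS x hxS, (hH x (hne x hxS)).2 hxH⟩, hf x⟩
    · rintro ⟨y, ⟨hyS, hyH⟩, rfl⟩
      exact ⟨hfS y hyS, fun h => (hH y (hne y hyS)).1 h hyH⟩
  have h1 := ncard_inter_add_ncard_sdiff_eq_ncard S H hS
  rw [himage, ncard_image_of_injective _ hf.injective] at h1
  omega

/-- In a connected space a set of vertices that is closed under edges contains all vertices. -/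
theorem IsSubdivision.eq_of_forall_edges {X : Type*} [MetricSpace X] [PreconnectedSpace X]
    {V W : Set X} (hV : IsSubdivision V) (hWV : W ⊆ V) (hne : W.Nonempty)
    (hW : ∀ e ∈ edgesOf V, ∀ w ∈ V ∩ closure e, ∀ w' ∈ V ∩ closure e, w ∈ W → w' ∈ W) :
    W = V := by
  set F : Set (Set X) := {e ∈ edgesOf V | (closure e ∩ W).Nonempty} with hF
  have h1 : IsOpen (W ∪ ⋃₀ F) :=
    hV.isOpen_union (sep_subset _ _) fun e he hew => ⟨he, hew⟩
  -- No edge joins `W` to its complement in `V`; so the two unions of vertices and edges are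
  -- disjoint open sets that cover the space.
  have h2 : IsOpen (V \ W ∪ ⋃₀ (edgesOf V \ F)) := by
    refine hV.isOpen_union sdiff_subset ?_
    rintro e he ⟨w, hwe, hwV, hwW⟩
    refine ⟨he, ?_⟩
    rintro ⟨-, w', hwe', hwW'⟩
    exact hwW (hW e he w' ⟨hWV hwW', hwe'⟩ w ⟨hwV, hwe⟩ hwW')
  have hnotV : ∀ e ∈ edgesOf V, ∀ x ∈ e, x ∉ V := by
    rintro e ⟨γ, s, t, hs⟩ x hx
    exact disjoint_left.1 hs.disjoint hx
  have hdisj : Disjoint (W ∪ ⋃₀ F) (V \ W ∪ ⋃₀ (edgesOf V \ F)) := by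
    rw [disjoint_left]
    rintro x (hx | ⟨e, he, hx⟩) (hx' | ⟨e', he', hx'⟩)
    · exact hx'.2 hx
    · exact hnotV e' he'.1 x hx' (hWV hx)
    · exact hnotV e he.1 x hx hx'.1
    · exact he'.2 (eq_of_mem_edgesOf he.1 he'.1 ⟨x, hx, hx'⟩ ▸ he)
  have hcover : (univ : Set X) ⊆ (W ∪ ⋃₀ F) ∪ (V \ W ∪ ⋃₀ (edgesOf V \ F)) := by
    intro x _
    by_cases hxV : x ∈ V
    · by_cases hxW : x ∈ W
      exacts [Or.inl (Or.inl hxW), Or.inr (Or.inl ⟨hxV, hxW⟩)]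
    · obtain ⟨e, he, hxe⟩ := hV.cover hxV
      by_cases heF : e ∈ F
      exacts [Or.inl (Or.inr ⟨e, heF, hxe⟩), Or.inr (Or.inr ⟨e, ⟨he, heF⟩, hxe⟩)]
  have hall := isPreconnected_univ.subset_left_of_subset_union h1 h2 hdisj hcover
    (hne.mono fun x hx => ⟨mem_univ x, Or.inl hx⟩)
  refine hWV.antisymm fun v hv => ?_
  rcases hall (mem_univ v) with h | ⟨e, he, hve⟩
  · exact h
  · exact absurd hv (hnotV e he.1 v hve)

/-! ### Conjugate edges and colourings of the nonreal part -/

section Involution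

variable {Γ : Type*} [MetricSpace Γ] {ι : Γ → Γ} {V : Set Γ}

theorem IsRealStructure.image_eq_preimage (hι : IsRealStructure ι) (s : Set Γ) :
    ι '' s = ι ⁻¹' s :=
  congrFun (image_eq_preimage_of_inverse hι.involutive.leftInverse hι.involutive.rightInverse) s

theorem IsRealStructure.mem_realLocus_iff (hι : IsRealStructure ι) {x : Γ} :
    ι x ∈ realLocus ι ↔ x ∈ realLocus ι :=
  hι.involutive.injective.eq_iff

theorem IsRealStructure.involutive_image (hι : IsRealStructure ι) :
    Function.Involutive (image ι) :=
  hι.image_image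

theorem map_mem_of_image_eq {α : Type*} {ι : α → α} {V : Set α} (hιV : ι '' V = V) {x : α}
    (hx : x ∈ V) : ι x ∈ V :=
  hιV ▸ mem_image_of_mem ι hx

theorem IsRealStructure.image_mem_edgesOf (hι : IsRealStructure ι) (hιV : ι '' V = V) {e : Set Γ}
    (he : e ∈ edgesOf V) : ι '' e ∈ edgesOf V := by
  obtain ⟨γ, s, t, hs⟩ := he
  refine ⟨ι ∘ γ, s, t, hs.lt, fun x hx y hy => ?_, map_mem_of_image_eq hιV hs.left_mem,
    map_mem_of_image_eq hιV hs.right_mem, ?_, ?_, ?_⟩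
  · rw [Function.comp, Function.comp, hι.isometry.dist_eq, hs.isometryOn x hx y hy]
  · rw [image_comp, ← hs.eq]
  · rw [hι.image_eq_preimage]
    exact hs.isOpen.preimage hι.isometry.continuous
  · rw [← hιV]
    exact (disjoint_image_iff hι.involutive.injective).2 hs.disjoint

theorem IsRealStructure.map_mem_closure (hι : IsRealStructure ι) {e : Set Γ} {x : Γ}
    (hx : x ∈ closure e) : ι x ∈ closure (ι '' e) :=
  image_closure_subset_closure_image hι.isometry.continuous ⟨x, hx, rfl⟩

/-- The real structure maps no edge outside of the real locus to itself. -/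
theorem IsRealStructure.image_ne (hι : IsRealStructure ι) {e : Set Γ} (he : e ∈ edgesOf V)
    (hd : Disjoint e (realLocus ι)) : ι '' e ≠ e := by
  intro heq
  obtain ⟨γ, s, t, hs⟩ := he
  obtain ⟨f, hf, rfl⟩ := (nonempty_homeomorph_real_iff hs.isOpen).1 hs.nonempty_homeomorph
  have hex : ∀ t, ∃ t', f t' = ι (f t) := fun t => by
    have : ι (f t) ∈ ι '' range f := mem_image_of_mem ι ⟨t, rfl⟩
    rwa [heq] at this
  choose g hg using hex
  have hgc : Continuous g := by
    rw [hf.isInducing.continuous_iff]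
    exact (hι.isometry.continuous.comp hf.continuous).congr fun t => (hg t).symm
  have hgg : g (g 0) = 0 := hf.injective (by rw [hg, hg, hι.involutive])
  -- As `g` exchanges `0` and `g 0`, the difference `g t - t` has opposite signs at these two
  -- points, so the involution `g` has a fixed point. It would be a real point of the edge.
  obtain ⟨t, ht⟩ : (0 : ℝ) ∈ range fun t => g t - t := by
    have hc : Continuous fun t => g t - t := hgc.sub continuous_id
    rcases le_total (g 0) 0 with h | h
    · exact mem_range_of_exists_le_of_exists_ge hc ⟨0, by simpa using h⟩
        ⟨g 0, by rw [hgg]; linarith⟩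
    · exact mem_range_of_exists_le_of_exists_ge hc ⟨g 0, by rw [hgg]; linarith⟩
        ⟨0, by simpa using h⟩
  refine disjoint_left.1 hd ⟨t, rfl⟩ ?_
  change ι (f t) = f t
  rw [← hg, sub_eq_zero.1 ht]

/-- The edges outside of the real locus. -/
def nonrealEdges (ι : Γ → Γ) (V : Set Γ) : Set (Set Γ) :=
  {e ∈ edgesOf V | Disjoint e (realLocus ι)}

theorem IsRealStructure.image_mem_nonrealEdges (hι : IsRealStructure ι) (hιV : ι '' V = V)
    {e : Set Γ} (he : e ∈ nonrealEdges ι V) : ι '' e ∈ nonrealEdges ι V := by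
  refine ⟨hι.image_mem_edgesOf hιV he.1, disjoint_left.2 ?_⟩
  rintro _ ⟨x, hx, rfl⟩ hR
  exact disjoint_left.1 he.2 hx (hι.mem_realLocus_iff.1 hR)

theorem mem_nonrealEdges_of_mem_closure (hι : IsRealStructure ι)
    (hf : frontier (realLocus ι) ⊆ V) {e : Set Γ} (he : e ∈ edgesOf V) {w : Γ}
    (hw : w ∈ closure e) (hwR : w ∉ realLocus ι) : e ∈ nonrealEdges ι V :=
  ⟨he, (subset_or_disjoint_realLocus hf he).resolve_left fun h =>
    hwR (closure_minimal h hι.isClosed_realLocus hw)⟩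

/-- A two-valued function on the vertices and edges outside of the real locus that is constant along
incidences and changed by the real structure separates all points from their conjugates. -/
theorem not_joinedIn_of_coloring (hι : IsRealStructure ι) (hV : IsSubdivision V)
    (hιV : ι '' V = V) (hf : frontier (realLocus ι) ⊆ V) {χ : Γ → ZMod 2} {τ : Set Γ → ZMod 2}
    (hχ : ∀ v ∈ V \ realLocus ι, χ (ι v) = χ v + 1)
    (hτ : ∀ e ∈ nonrealEdges ι V, τ (ι '' e) = τ e + 1)
    (hχτ : ∀ e ∈ nonrealEdges ι V, ∀ w ∈ V \ realLocus ι, w ∈ closure e → τ e = χ w) {p : Γ}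
    (hp : p ∉ realLocus ι) : ¬ JoinedIn (realLocus ι)ᶜ p (ι p) := by
  set U : ZMod 2 → Set Γ := fun i =>
    -- The colour classes are open and disjoint, cover the nonreal points and are exchanged by `ι`;
    -- a path without real points stays in one of them.
    {v ∈ V \ realLocus ι | χ v = i} ∪ ⋃₀ {e ∈ nonrealEdges ι V | τ e = i} with hU
  have hopen : ∀ i, IsOpen (U i) := by
    intro i
    refine hV.isOpen_union (fun e he => he.1.1) ?_
    rintro e he ⟨w, hwe, hw, rfl⟩
    have hen := mem_nonrealEdges_of_mem_closure hι hf he hwe hw.2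
    exact ⟨hen, hχτ e hen w hw hwe⟩
  have hnotV : ∀ e ∈ nonrealEdges ι V, ∀ x ∈ e, x ∉ V := by
    rintro e ⟨⟨γ, s, t, hs⟩, -⟩ x hx
    exact disjoint_left.1 hs.disjoint hx
  have huniq : ∀ i j x, x ∈ U i → x ∈ U j → i = j := by
    rintro i j x (⟨hx, hi⟩ | ⟨e, ⟨he, hi⟩, hxe⟩) (⟨hx', hj⟩ | ⟨e', ⟨he', hj⟩, hxe'⟩)
    · exact hi.symm.trans hj
    · exact absurd hx.1 (hnotV e' he' x hxe')
    · exact absurd hx'.1 (hnotV e he x hxe)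
    · rw [← hi, ← hj, eq_of_mem_edgesOf he.1 he'.1 ⟨x, hxe, hxe'⟩]
  have hconj : ∀ i x, x ∈ U i → ι x ∈ U (i + 1) := by
    rintro i x (⟨hx, rfl⟩ | ⟨e, ⟨he, rfl⟩, hxe⟩)
    · exact Or.inl ⟨⟨map_mem_of_image_eq hιV hx.1, fun h => hx.2 (hι.mem_realLocus_iff.1 h)⟩, hχ x hx⟩
    · exact Or.inr ⟨ι '' e, ⟨hι.image_mem_nonrealEdges hιV he, hτ e he⟩, x, hxe, rfl⟩
  have hcover : ∀ x ∉ realLocus ι, ∃ i, x ∈ U i := by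
    intro x hx
    by_cases hxV : x ∈ V
    · exact ⟨χ x, Or.inl ⟨⟨hxV, hx⟩, rfl⟩⟩
    · obtain ⟨e, he, hxe⟩ := hV.cover hxV
      exact ⟨τ e, Or.inr ⟨e, ⟨mem_nonrealEdges_of_mem_closure hι hf he (subset_closure hxe) hx, rfl⟩,
        hxe⟩⟩
  rintro ⟨γ, hγ⟩
  obtain ⟨i, hi⟩ := hcover p hp
  have hsub : range γ ⊆ U i := by
    refine (isPreconnected_range γ.continuous).subset_left_of_subset_union (hopen i)
      (isOpen_iUnion fun j : {j // j ≠ i} => hopen j) ?_ ?_ ⟨p, ⟨0, γ.source⟩, hi⟩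
    · rw [disjoint_left]
      intro x hx hx'
      obtain ⟨j, hj⟩ := mem_iUnion.1 hx'
      exact j.2 (huniq _ _ x hj hx)
    · rintro _ ⟨t, rfl⟩
      obtain ⟨j, hj⟩ := hcover _ (hγ t)
      by_cases hji : j = i
      · exact Or.inl (hji ▸ hj)
      · exact Or.inr (mem_iUnion.2 ⟨⟨j, hji⟩, hj⟩)
  have h := huniq _ _ _ (hsub ⟨1, γ.target⟩) (hconj i p hi)
  exact one_ne_zero (α := ZMod 2) (by linear_combination -h)

end Involution

/-! ### The quotient graph with contracted real components -/

section Count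

variable {Γ : Type*} [MetricSpace Γ] {ι : Γ → Γ} {V : Set Γ}

/-- The nodes of the quotient by the real structure in which every component of the real locus is
contracted: `A` contains one vertex of every nonreal orbit. -/
theorem exists_node_map (hι : IsRealStructure ι) {A : Set Γ}
    (hAV : A ⊆ V \ realLocus ι) (hA : ∀ v ∈ V \ realLocus ι, ι v ∈ A ↔ v ∉ A) :
    ∃ π : V → A ⊕ ConnectedComponents (realLocus ι),
      (∀ (v : V) (hR : v.1 ∈ realLocus ι), π v = Sum.inr (ConnectedComponents.mk ⟨v, hR⟩)) ∧
      (∀ (v : V) (hvA : v.1 ∈ A), π v = Sum.inl ⟨v, hvA⟩) ∧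
      ∀ v w : V, w.1 = ι v → π w = π v := by
  classical
  have hιA : ∀ v : V, v.1 ∉ realLocus ι → v.1 ∉ A → ι v ∈ A := fun v hR hvA =>
    (hA v ⟨v.2, hR⟩).2 hvA
  refine ⟨fun v => if hR : v.1 ∈ realLocus ι then Sum.inr (ConnectedComponents.mk ⟨v, hR⟩) else
    if hvA : v.1 ∈ A then Sum.inl ⟨v, hvA⟩ else Sum.inl ⟨ι v, hιA v hR hvA⟩, ?_, ?_, ?_⟩
  · intro v hR
    simp only [dif_pos hR]
  · intro v hvA
    simp only [dif_neg (hAV hvA).2, dif_pos hvA]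
  · rintro ⟨v, hv⟩ ⟨_, hw⟩ rfl
    by_cases hR : v ∈ realLocus ι
    · have : ι v = v := hR
      simp only [this]
    · have hR' : ι v ∉ realLocus ι := fun h => hR (hι.mem_realLocus_iff.1 h)
      by_cases hvA : v ∈ A
      · have : ι v ∉ A := fun h => (hA v ⟨hv, hR⟩).1 h hvA
        simp only [dif_neg hR', dif_neg hR, dif_neg this, dif_pos hvA, hι.involutive v]
      · simp only [dif_neg hR', dif_neg hR, dif_pos (hιA ⟨v, hv⟩ hR hvA), dif_neg hvA]

/-- Outside of the real locus, a function on the vertices that is changed by the real structure and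
constant along edges extends to the edges. -/
theorem not_joinedIn_of_vertex_coloring (hι : IsRealStructure ι) (hV : IsSubdivision V)
    (hιV : ι '' V = V) (hf : frontier (realLocus ι) ⊆ V) {χ : Γ → ZMod 2}
    (hχ : ∀ v ∈ V \ realLocus ι, χ (ι v) = χ v + 1)
    (hconst : ∀ e ∈ nonrealEdges ι V, ∀ w ∈ V \ realLocus ι, ∀ w' ∈ V \ realLocus ι,
      w ∈ closure e → w' ∈ closure e → χ w = χ w') {p : Γ} (hp : p ∉ realLocus ι) :
    ¬ JoinedIn (realLocus ι)ᶜ p (ι p) := by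
  classical
  obtain ⟨H, hH⟩ := exists_half hι.involutive_image
  -- An edge inherits the colour of a nonreal end point. If it has none, its colour is subject to no
  -- incidence condition, and a choice of one edge in each conjugate pair provides it.
  set τ : Set Γ → ZMod 2 := fun e =>
    if h : ∃ w ∈ V \ realLocus ι, w ∈ closure e then χ h.choose else if e ∈ H then 1 else 0
    with hτ
  have hχτ : ∀ e ∈ nonrealEdges ι V, ∀ w ∈ V \ realLocus ι, w ∈ closure e → τ e = χ w := by
    intro e he w hw hwe
    have h : ∃ w ∈ V \ realLocus ι, w ∈ closure e := ⟨w, hw, hwe⟩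
    simp only [hτ, dif_pos h]
    exact hconst e he _ h.choose_spec.1 w hw h.choose_spec.2 hwe
  have hιmem : ∀ w ∈ V \ realLocus ι, ι w ∈ V \ realLocus ι := fun w hw =>
    ⟨map_mem_of_image_eq hιV hw.1, fun h => hw.2 (hι.mem_realLocus_iff.1 h)⟩
  refine not_joinedIn_of_coloring hι hV hιV hf hχ (τ := τ) ?_ hχτ hp
  intro e he
  have he' := hι.image_mem_nonrealEdges hιV he
  by_cases h : ∃ w ∈ V \ realLocus ι, w ∈ closure e
  · obtain ⟨w, hw, hwe⟩ := h
    rw [hχτ e he w hw hwe, hχτ _ he' (ι w) (hιmem w hw) (hι.map_mem_closure hwe), hχ w hw]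
  · have h' : ¬ ∃ w ∈ V \ realLocus ι, w ∈ closure (ι '' e) := by
      rintro ⟨w, hw, hwe⟩
      refine h ⟨ι w, hιmem w hw, ?_⟩
      have := hι.map_mem_closure hwe
      rwa [hι.image_image] at this
    have hHe := hH e (hι.image_ne he.1 he.2)
    simp only [hτ, dif_neg h, dif_neg h']
    by_cases heH : e ∈ H
    · rw [if_pos heH, if_neg fun h => hHe.1 h heH]
      rfl
    · rw [if_neg heH, if_pos (hHe.2 heH), zero_add]

/-- The nonreal vertices and edges come in conjugate pairs. The quotient by the real structure, with
the components of the real locus contracted, is connected, and if it is a tree, then no nonreal point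
can be joined to its conjugate outside of the real locus. -/
theorem exists_card_nonreal [ConnectedSpace Γ] (hι : IsRealStructure ι) (hV : IsSubdivision V)
    (hιV : ι '' V = V) (hf : frontier (realLocus ι) ⊆ V) :
    ∃ a b : ℕ, (V \ realLocus ι).ncard = 2 * a ∧ (nonrealEdges ι V).ncard = 2 * b ∧
      a + Nat.card (ConnectedComponents (realLocus ι)) ≤ b + 1 ∧
      (b < a + Nat.card (ConnectedComponents (realLocus ι)) →
        ∀ p ∉ realLocus ι, ¬ JoinedIn (realLocus ι)ᶜ p (ι p)) := by
  classical
  have hfinC := finite_connectedComponents_realLocus hι hV hf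
  obtain ⟨H, hH⟩ := exists_half hι.involutive
  obtain ⟨H', hH'⟩ := exists_half hι.involutive_image
  have hιmem : ∀ w ∈ V \ realLocus ι, ι w ∈ V \ realLocus ι := fun w hw =>
    ⟨map_mem_of_image_eq hιV hw.1, fun h => hw.2 (hι.mem_realLocus_iff.1 h)⟩
  have hιE : ∀ e ∈ nonrealEdges ι V, ι '' e ∈ nonrealEdges ι V := fun e he =>
    hι.image_mem_nonrealEdges hιV he
  set A := (V \ realLocus ι) ∩ H with hA
  set B := nonrealEdges ι V ∩ H' with hB
  have hVf : (V \ realLocus ι).Finite := hV.finite.sdiff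
  have hEf : (nonrealEdges ι V).Finite := hV.finite_edges.subset (sep_subset _ _)
  have : Finite A := (hVf.subset inter_subset_left).to_subtype
  have : Finite B := (hEf.subset inter_subset_left).to_subtype
  have hcardA : (V \ realLocus ι).ncard = 2 * A.ncard :=
    ncard_eq_two_mul_half hι.involutive hH hVf hιmem fun v hv => hv.2
  have hcardB : (nonrealEdges ι V).ncard = 2 * B.ncard :=
    ncard_eq_two_mul_half hι.involutive_image hH' hEf hιE fun e he => hι.image_ne he.1 he.2
  obtain ⟨π, hπR, hπA, hπι⟩ := exists_node_map hι (A := A) inter_subset_left fun v hv => by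
    rw [hA, mem_inter_iff, mem_inter_iff, and_iff_right (hιmem v hv), and_iff_right hv]
    exact hH v hv.2
  have hends : ∀ e : edgesOf V, ∃ u v : V, ∀ w : V, w.1 ∈ closure e.1 ↔ w = u ∨ w = v := by
    rintro ⟨e, γ, s, t, hs⟩
    refine ⟨⟨_, hs.left_mem⟩, ⟨_, hs.right_mem⟩, fun w => ?_⟩
    rw [hs.closure_eq]
    constructor
    · rintro (h | h | h)
      exacts [absurd w.2 (disjoint_left.1 hs.disjoint h), Or.inl (Subtype.ext h),
        Or.inr (Subtype.ext h)]
    · rintro (rfl | rfl)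
      exacts [Or.inr (Or.inl rfl), Or.inr (Or.inr rfl)]
  choose u v huv using hends
  have hmemE : ∀ b : B, b.1 ∈ edgesOf V := fun b => b.2.1.1
  have hιw : ∀ w : V, ι w ∈ V := fun w => map_mem_of_image_eq hιV w.2
  -- The graph has the orbits of nonreal vertices and the real components as nodes, and the
  -- representatives `B` of the nonreal edge pairs as edges.
  have hgraph := card_nodes_le (fun b : B => π (u ⟨b, hmemE b⟩)) (fun b : B => π (v ⟨b, hmemE b⟩))
    (by
      intro ψ hψ
      have hBe : ∀ e ∈ B, ∀ w w' : V, w.1 ∈ closure e → w'.1 ∈ closure e →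
          ψ (π w) = ψ (π w') := by
        intro e he w w' hw hw'
        rcases (huv ⟨e, he.1.1⟩ w).1 hw with rfl | rfl <;>
          rcases (huv ⟨e, he.1.1⟩ w').1 hw' with rfl | rfl
        exacts [rfl, hψ ⟨e, he⟩, (hψ ⟨e, he⟩).symm, rfl]
      -- The contraction `π` sends both ends of a real edge to the same node, and an edge outside of
      -- `B` has the same ends in the quotient as its conjugate in `B`.
      have hedge : ∀ e ∈ edgesOf V, ∀ w w' : V, w.1 ∈ closure e → w'.1 ∈ closure e →
          ψ (π w) = ψ (π w') := by
        intro e he w w' hw hw'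
        rcases subset_or_disjoint_realLocus hf he with hR | hR
        · have hclR := closure_minimal hR hι.isClosed_realLocus
          obtain ⟨γ, s, t, hs⟩ := he
          rw [hπR w (hclR hw), hπR w' (hclR hw'),
            mk_eq_mk_of_isPreconnected hs.isPreconnected.closure hclR hw hw']
        · by_cases heH : e ∈ H'
          · exact hBe e ⟨⟨he, hR⟩, heH⟩ w w' hw hw'
          · rw [← hπι w ⟨ι w, hιw w⟩ rfl, ← hπι w' ⟨ι w', hιw w'⟩ rfl]
            exact hBe (ι '' e) ⟨hιE e ⟨he, hR⟩, (hH' e (hι.image_ne he hR)).2 heH⟩ _ _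
              (hι.map_mem_closure hw) (hι.map_mem_closure hw')
      have hsurj : Function.Surjective π := by
        rintro (⟨a, ha⟩ | C)
        · exact ⟨⟨a, ha.1.1⟩, hπA _ ha⟩
        · obtain ⟨w, hwV, hwC⟩ := exists_vertex_mem_realComponent hι hV hf C
          obtain ⟨hR, rfl⟩ := mem_range_realComponentIncl.1 hwC
          exact ⟨⟨w, hwV⟩, hπR _ hR⟩
      intro x y
      obtain ⟨x, rfl⟩ := hsurj x
      obtain ⟨y, rfl⟩ := hsurj y
      have hW : Subtype.val '' {w : V | ψ (π w) = ψ (π y)} = V := by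
        refine hV.eq_of_forall_edges (by rintro _ ⟨w, -, rfl⟩; exact w.2) ⟨y, y, rfl, rfl⟩ ?_
        rintro e he _ ⟨-, hwe⟩ w' ⟨hw', hwe'⟩ ⟨w, hw, rfl⟩
        exact ⟨⟨w', hw'⟩, (hedge e he ⟨w', hw'⟩ w hwe' hwe).trans hw, rfl⟩
      obtain ⟨w, hw, hwx⟩ := hW.symm.subset x.2
      rwa [Subtype.ext hwx] at hw)
  rw [Nat.card_sum, Nat.card_coe_set_eq, Nat.card_coe_set_eq] at hgraph
  refine ⟨A.ncard, B.ncard, hcardA, hcardB, hgraph.1, fun hlt p hp => ?_⟩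
  set σ : Γ → ZMod 2 := fun x => if x ∈ H then 1 else 0 with hσ
  -- The indicator `σ` of `H` is changed by `ι` at nonreal vertices but may jump along edges. In a
  -- tree these jumps form the coboundary of some `ψ`. Since `ψ ∘ π` is invariant under `ι`, adding
  -- it to `σ` cancels the jumps and keeps the change under conjugation.
  obtain ⟨ψ, hψ⟩ := hgraph.2 hlt fun b => σ (u ⟨b, hmemE b⟩) + σ (v ⟨b, hmemE b⟩)
  set χ : Γ → ZMod 2 := fun x => σ x + if h : x ∈ V then ψ (π ⟨x, h⟩) else 0 with hχ
  have hχV : ∀ w : V, χ w = σ w + ψ (π w) := fun w => by simp only [hχ, dif_pos w.2]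
  have hχι : ∀ w ∈ V \ realLocus ι, χ (ι w) = χ w + 1 := by
    intro w hw
    rw [hχV ⟨w, hw.1⟩, hχV ⟨ι w, hιw ⟨w, hw.1⟩⟩, hπι ⟨w, hw.1⟩ ⟨ι w, hιw ⟨w, hw.1⟩⟩ rfl]
    have hHw := hH w hw.2
    have : σ (ι w) = σ w + 1 := by
      simp only [hσ]
      by_cases hwH : w ∈ H
      · rw [if_pos hwH, if_neg fun h => hHw.1 h hwH]
        rfl
      · rw [if_neg hwH, if_pos (hHw.2 hwH), zero_add]
    rw [this]
    ring
  have htwo : ∀ a b c d : ZMod 2, a + b = c + d → c + a = d + b := by decide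
  have hBe : ∀ e ∈ B, ∀ w w' : V, w.1 ∈ closure e → w'.1 ∈ closure e → χ w = χ w' := by
    intro e he w w' hw hw'
    have := htwo _ _ _ _ (hψ ⟨e, he⟩)
    rcases (huv ⟨e, he.1.1⟩ w).1 hw with rfl | rfl <;>
      rcases (huv ⟨e, he.1.1⟩ w').1 hw' with rfl | rfl
    · rfl
    · rw [hχV, hχV]; exact this
    · rw [hχV, hχV]; exact this.symm
    · rfl
  refine not_joinedIn_of_vertex_coloring hι hV hιV hf hχι ?_ hp
  intro e he w hw w' hw' hwe hwe'
  by_cases heH : e ∈ H'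
  · exact hBe e ⟨he, heH⟩ ⟨w, hw.1⟩ ⟨w', hw'.1⟩ hwe hwe'
  -- The conjugate edge lies in `B`; conjugation adds `1` to the colour at both ends, which cancels.
  · have := hBe (ι '' e) ⟨hιE e he, (hH' e (hι.image_ne he.1 he.2)).2 heH⟩ ⟨ι w, hιw ⟨w, hw.1⟩⟩
      ⟨ι w', hιw ⟨w', hw'.1⟩⟩ (hι.map_mem_closure hwe) (hι.map_mem_closure hwe')
    rw [hχι w hw, hχι w' hw'] at this
    exact add_right_cancel this

theorem ncard_edgesOf_eq (hV : IsSubdivision V) (hf : frontier (realLocus ι) ⊆ V) :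
    (edgesOf V).ncard = {e ∈ edgesOf V | e ⊆ realLocus ι}.ncard + (nonrealEdges ι V).ncard := by
  rw [← ncard_union_eq (t := nonrealEdges ι V) ?_ (hV.finite_edges.subset (sep_subset _ _))
    (hV.finite_edges.subset (sep_subset _ _))]
  · congr 1
    ext e
    constructor
    · intro he
      rcases subset_or_disjoint_realLocus hf he with h | h
      exacts [Or.inl ⟨he, h⟩, Or.inr ⟨he, h⟩]
    · rintro (he | he)
      exacts [he.1, he.1]
  · rw [disjoint_left]
    rintro e ⟨⟨γ, s, t, hs⟩, hR⟩ ⟨-, hd⟩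
    obtain ⟨x, hx⟩ := hs.nonempty
    exact disjoint_left.1 hd hx (hR hx)

end Count

end RealMetricGraph

/-! ### The proposition -/

theorem proposition4 {Γ : Type*} [MetricSpace Γ] (hΓ : RealMetricGraph.IsMetricGraph Γ)
    (ι : Γ → Γ) (hι : RealMetricGraph.IsRealStructure ι) :
    (RealMetricGraph.IsFiniteGraph Γ ∧
      Finite (ConnectedComponents (RealMetricGraph.realLocus ι)) ∧
      ∀ C : ConnectedComponents (RealMetricGraph.realLocus ι),
        RealMetricGraph.IsFiniteGraph (RealMetricGraph.realComponent ι C)) ∧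
    RealMetricGraph.sInvariant ι ≤ RealMetricGraph.genus Γ + 1 ∧
    RealMetricGraph.sInvariant ι ≡ RealMetricGraph.genus Γ + 1 [ZMOD 2] ∧
    (RealMetricGraph.aInvariant ι = 1 →
      RealMetricGraph.sInvariant ι ≤ RealMetricGraph.genus Γ - 1) := by
  have := hΓ.connected
  obtain ⟨V, hV, hιV, hf⟩ := hΓ.exists_isSubdivision hι
  obtain ⟨hfin, hgenus⟩ := hV.isFiniteGraph_and_genus_eq
  have hs := RealMetricGraph.sInvariant_eq hι hV hf
  obtain ⟨a, b, ha, hb, hle, hlt⟩ := RealMetricGraph.exists_card_nonreal hι hV hιV hf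
  have hE := RealMetricGraph.ncard_edgesOf_eq hV hf
  have hVc := ncard_inter_add_ncard_sdiff_eq_ncard V (RealMetricGraph.realLocus ι) hV.finite
  rw [RealMetricGraph.nat_card_connectedComponents] at hgenus
  refine ⟨⟨hfin, RealMetricGraph.finite_connectedComponents_realLocus hι hV hf,
    fun C => (RealMetricGraph.isFiniteGraph_and_genus_realComponent hι hV hf C).1⟩, by omega, ?_, ?_⟩
  -- The witness is half of `g + 1 - s`, the real vertices and edges having cancelled.
  · refine (Int.modEq_iff_dvd).2
      ⟨1 + b - a - Nat.card (ConnectedComponents (RealMetricGraph.realLocus ι)), ?_⟩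
    omega
  · intro ha1
    have hex : ∃ p : Γ, p ∉ RealMetricGraph.realLocus ι ∧
        JoinedIn (RealMetricGraph.realLocus ι)ᶜ p (ι p) := by
      by_contra hn
      rw [RealMetricGraph.aInvariant, if_neg hn] at ha1
      exact zero_ne_one ha1
    obtain ⟨p, hp, hj⟩ := hex
    -- A path from `p` to its conjugate excludes the tree case, and the bound improves by `1` in the
    -- quotient, hence by `2` for `s`.
    have : ¬ b < a + Nat.card (ConnectedComponents (RealMetricGraph.realLocus ι)) :=
      fun h => hlt h p hp hj
    omega
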